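/- There are absolute constants $c>0$ and $C>0$ such that the following holds for all integers $d$, $m$ and $r\ge 1$. Let $A,N\in\mathbb{R}^{d\times m}$, $F\in\mathbb{R}^{d\times r}$ and $\widetilde A=A+N$, and suppose that $A=FW$ with $W=(I,K)\Pi$, where $I$ is the $r\times r$ identity matrix, $K\in\mathbb{R}^{r\times(m-r)}$ is entrywise nonnegative with every column sum at most $1$, $\Pi$ is an $m\times m$ permutation matrix, and $\operatorname{rank}F=r$. Let $\varepsilon=\|N\|_2$ (the matrix 2-norm), let $\sigma_{\max}(F)$ and $\sigma_{\min}(F)$ be the largest and the smallest of the singular values $\sigma_1\ge\dots\ge\sigma_r$ of $F$, and let $\kappa(F)=\sigma_{\max}(F)/\sigma_{\min}(F)$. If $$\varepsilon\le c\,\frac{\sigma_{\min}(F)}{r\sqrt r},$$ then the preconditioned successive projection algorithm below, on the input $(\widetilde A,r)$, returns a set $\mathcal I\subseteq\{1,\dots,m\}$ of $r$ indices that can be ordered as $\mathcal I(1),\dots,\mathcal I(r)$ so that $$\max_{1\le j\le r}\|\widetilde a_{\mathcal I(j)}-f_j\|_2\le C\,\kappa(F)\,\varepsilon ,$$ where $\widetilde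 a_i$ and $f_j$ are the columns of $\widetilde A$ and $F$. This holds whichever singular value decomposition, optimal solution and maximizing indices the algorithm uses; in particular each of its steps can be carried out. Preconditioned successive projection algorithm on $(\widetilde A,r)$: (1) take a singular value decomposition $\widetilde A=U\Sigma V^\top$ ($U\in\mathbb{R}^{d\times d}$ and $V\in\mathbb{R}^{m\times m}$ orthogonal, $\Sigma$ a $d\times m$ diagonal matrix with entries $\sigma_1\ge\sigma_2\ge\dots\ge0$) and put $P=\operatorname{diag}(\sigma_1,\dots,\sigma_r)(v_1,\dots,v_r)^\top\in\mathbb{R}^{r\times m}$, with $v_k$ the columns of $V$; (2) let $L^*$ be an optimal solution of the problem of minimizing $-\log\det L$ over the symmetric positive definite $r\times r$ matrices $L$ with $p_i^\top Lp_i\le1$ for every column $p_i$ of $P$; (3) put $S=(L^*)^{1/2}P$ and $\mathcal I=\emptyset$, and as long as $|\mathcal I|<r$ choose an index $i^*$ that maximizes $\|s_i\|_2^2$ over the columns $s_i$ of $S$, put $t=s_{i^*}$, replace $S$ by $(I-tt^\top/\|t\|_2^2)S$ and add $i^*$ to $\mathcal I$; return $\mathcal I$. -/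

import Mathlib

namespace PrecondSPA

noncomputable section

/-- The `j`-th column of a real matrix, as a vector with the Euclidean norm. -/
def col {d m : ℕ} (M : Matrix (Fin d) (Fin m) ℝ) (j : Fin m) : EuclideanSpace ℝ (Fin d) :=
  WithLp.toLp 2 (fun i => M i j)

open scoped Matrix.Norms.L2Operator in
/-- The matrix 2-norm (operator norm for the Euclidean norms). -/
def specNorm {d m : ℕ} (M : Matrix (Fin d) (Fin m) ℝ) : ℝ := ‖M‖

/-- The largest singular value. -/
def sigmaMax {d m : ℕ} (M : Matrix (Fin d) (Fin m) ℝ) : ℝ :=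
  (Matrix.toEuclideanLin M).singularValues 0

/-- The smallest of the `min d m` singular values (Mathlib's sequence is in descending order and
indexed from `0`). -/
def sigmaMin {d m : ℕ} (M : Matrix (Fin d) (Fin m) ℝ) : ℝ :=
  (Matrix.toEuclideanLin M).singularValues (min d m - 1)

/-- The condition number. -/
def cond {d m : ℕ} (M : Matrix (Fin d) (Fin m) ℝ) : ℝ := sigmaMax M / sigmaMin M

/-- `A = F W` with `W = (I, K) Π` nonnegative, `F` of full column rank `r` and every column of `K`
of sum at most one. The bijection `e` places the columns of `(I, K)`: it plays the role of the
permutation matrix `Π`, and its existence forces `r ≤ m`. -/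
def SeparableWith {d m r : ℕ} (A : Matrix (Fin d) (Fin m) ℝ) (F : Matrix (Fin d) (Fin r) ℝ) :
    Prop :=
  F.rank = r ∧
  ∃ (K : Matrix (Fin r) (Fin (m - r)) ℝ) (e : Fin m ≃ Fin r ⊕ Fin (m - r)),
    (∀ k i, 0 ≤ K k i) ∧
    (∀ i, ∑ k, K k i ≤ 1) ∧
    A = F * (Matrix.fromCols (1 : Matrix (Fin r) (Fin r) ℝ) K).submatrix id e

/-! ### The successive projection algorithm -/

/-- `i` maximizes the squared norm of the columns of `S`. -/
def IsPivot {d m : ℕ} (S : Matrix (Fin d) (Fin m) ℝ) (i : Fin m) : Prop :=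
  ∀ k, ‖col S k‖ ^ 2 ≤ ‖col S i‖ ^ 2

/-- `S ← (I - t tᵀ / ‖t‖²) S` for the column `t = s_i`. -/
def projectOut {d m : ℕ} (S : Matrix (Fin d) (Fin m) ℝ) (i : Fin m) :
    Matrix (Fin d) (Fin m) ℝ :=
  (1 - (‖col S i‖ ^ 2)⁻¹ • Matrix.vecMulVec (fun a => S a i) (fun a => S a i)) * S

/-- `SPALoop r Q S I`: started in the state `(S, I)`, the loop of the successive projection
algorithm always stops, whichever maximizing index is chosen at each step, never divides by zero,
and every index set that it can output satisfies `Q`. -/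
inductive SPALoop {d m : ℕ} (r : ℕ) (Q : Finset (Fin m) → Prop) :
    Matrix (Fin d) (Fin m) ℝ → Finset (Fin m) → Prop
  | halt {S : Matrix (Fin d) (Fin m) ℝ} {I : Finset (Fin m)}
      (hI : r ≤ I.card) (hQ : Q I) : SPALoop r Q S I
  | step {S : Matrix (Fin d) (Fin m) ℝ} {I : Finset (Fin m)}
      (hI : I.card < r)
      (hex : ∃ i, IsPivot S i)
      (hne : ∀ i, IsPivot S i → col S i ≠ 0)
      (hnext : ∀ i, IsPivot S i → SPALoop r Q (projectOut S i) (insert i I)) :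
      SPALoop r Q S I

/-- The successive projection algorithm on the input `(A, r)` returns an index set that
satisfies `Q`, however ties are broken. -/
def SPAReturns {d m : ℕ} (A : Matrix (Fin d) (Fin m) ℝ) (r : ℕ) (Q : Finset (Fin m) → Prop) :
    Prop :=
  SPALoop r Q A ∅

/-! ### The preconditioned algorithm -/

/-- `A = U Σ Vᵀ` is a singular value decomposition: `U`, `V` are orthogonal and `Σ` is the `d × m`
diagonal matrix of the numbers `σ`, which are nonnegative and in descending order. -/
structure IsSVD {d m : ℕ} (A : Matrix (Fin d) (Fin m) ℝ) (U : Matrix (Fin d) (Fin d) ℝ)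
    (σ : Fin (min d m) → ℝ) (V : Matrix (Fin m) (Fin m) ℝ) : Prop where
  left_orthogonal : U ∈ Matrix.orthogonalGroup (Fin d) ℝ
  right_orthogonal : V ∈ Matrix.orthogonalGroup (Fin m) ℝ
  nonneg : ∀ k, 0 ≤ σ k
  antitone : Antitone σ
  eq_mul : A = U * (Matrix.of fun (i : Fin d) (j : Fin m) =>
    if h : i.val = j.val then σ ⟨i.val, lt_min i.isLt (h ▸ j.isLt)⟩ else 0) * V.transpose

/-- The `r × m` matrix `P = diag(σ₁, …, σ_r) (v₁, …, v_r)ᵀ`. -/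
def reduced {d m r : ℕ} (h : r ≤ min d m) (σ : Fin (min d m) → ℝ)
    (V : Matrix (Fin m) (Fin m) ℝ) : Matrix (Fin r) (Fin m) ℝ :=
  Matrix.diagonal (fun k : Fin r => σ (Fin.castLE h k)) *
    (V.submatrix id (Fin.castLE (h.trans (min_le_right d m)))).transpose

/-- Feasibility in the ellipsoid problem of the columns `p` of `P`:
`L` is positive definite and `pᵀ L p ≤ 1` for each of them. -/
def EllipsoidFeasible {r m : ℕ} (P : Matrix (Fin r) (Fin m) ℝ) (L : Matrix (Fin r) (Fin r) ℝ) :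
    Prop :=
  L.PosDef ∧ ∀ i, (fun a => P a i) ⬝ᵥ L.mulVec (fun a => P a i) ≤ 1

/-- `L` is an optimal solution of the problem of minimizing `-log det L` over the feasible `L`. -/
def EllipsoidOptimal {r m : ℕ} (P : Matrix (Fin r) (Fin m) ℝ) (L : Matrix (Fin r) (Fin r) ℝ) :
    Prop :=
  EllipsoidFeasible P L ∧
    ∀ L', EllipsoidFeasible P L' → -Real.log L.det ≤ -Real.log L'.det

open scoped MatrixOrder in
/-- The preconditioned successive projection algorithm on the input `(A, r)` returns an index set
that satisfies `Q`: each of its steps can be carried out, and the output satisfies `Q` whichever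
singular value decomposition, optimal solution and maximizing indices are used. -/
def PrecondSPAReturns {d m : ℕ} (A : Matrix (Fin d) (Fin m) ℝ) (r : ℕ)
    (Q : Finset (Fin m) → Prop) : Prop :=
  ∃ h : r ≤ min d m,
    (∃ U σ V, IsSVD A U σ V) ∧
    ∀ U σ V, IsSVD A U σ V →
      (∃ L, EllipsoidOptimal (reduced h σ V) L) ∧
      ∀ L, EllipsoidOptimal (reduced h σ V) L →
        SPAReturns (CFC.sqrt L * reduced h σ V) r Q

/-- The size of the basis error, `max_j ‖ã_{I(j)} - f_j‖₂`, of an ordering `j ↦ I(j)`. -/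
def basisError {d m r : ℕ} (A : Matrix (Fin d) (Fin m) ℝ) (F : Matrix (Fin d) (Fin r) ℝ)
    (idx : Fin r → Fin m) : ℝ :=
  ⨆ j, ‖col A (idx j) - col F j‖

end

end PrecondSPA

namespace PrecondSPA

/-! Let `U_r` be the first `r` left singular vectors of the data `F * W + N`. Then `P = U_rᵀ (F * W
+ N)`, so with `G = U_rᵀ F` the columns of `P` are `G q_i`, where `q_i = w_i + G⁻¹ U_rᵀ n_i`. The
singular values after the `r`-th are at most `ε`, so the range of `F` lies within `O(ε)` of the span
of `U_r`. Hence `G` is bounded below by `σ_min(F) / 2`, and every `q_i` is within `δ = 2ε /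
σ_min(F)` of its weight vector `w_i`.

Preconditioning removes `κ(F)` from the selection step. Let `L = Bᵀ B` be optimal and `H = B G`.
Feasibility at the perturbed vertices gives `tr HᵀH ≤ r + small`. Comparison with the feasible
multiple of `G⁻ᵀ G⁻¹` gives `log det HᵀH ≥ -small`. Each eigenvalue has `λ - 1 - log λ ≥ 0`, so none
of these terms is large and all eigenvalues lie in `[1/2, 2]` (`bounds_of_ellipsoidOptimal`). The
power `r√r` is needed only for the trace bound.

For well-conditioned `H`, a pivot nearly attains the maximum norm among the projected vertices.
These are well separated, so strict convexity of the ball forces one weight of the pivot to be `1 -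
O(δ)` (`exists_dominant_weight`). Errors do not accumulate: earlier errors enter only through the
nondegeneracy of the residual. Finally the error `O(δ)` in `q` is mapped back through `G`, which
costs `σ_max(F)` and produces `κ(F) ε`. -/

open Matrix

/-! ### Successive projection with a well-conditioned factor -/

/-- If a convex combination `∑ w j • z j` (with slack at the origin) of vectors of norm at most `μ`
has norm close to `μ`, and the vectors of large norm are separated, then one weight dominates. -/
lemma exists_dominant_weight {ι E : Type*} [Fintype ι] [DecidableEq ι] [NormedAddCommGroup E]
    [InnerProductSpace ℝ E] (z : ι → E) (w : ι → ℝ) (J : Finset ι) {μ ρ θ : ℝ}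
    (hw0 : ∀ j, 0 ≤ w j) (hw1 : ∑ j, w j ≤ 1) (hμ : 0 < μ) (hz : ∀ j, ‖z j‖ ≤ μ)
    (hJ : ∀ j ∈ J, ‖z j‖ ≤ μ / 2)
    (hsep : ∀ j, j ∉ J → ∀ l, l ∉ J → j ≠ l → ρ ≤ ‖z j - z l‖) (hρ : 0 < ρ) (hρμ : ρ ≤ 2 * μ)
    (hθ : θ < ρ ^ 2 / (8 * μ)) (hv : μ - θ ≤ ‖∑ j, w j • z j‖) :
    ∃ j, j ∉ J ∧ 1 - w j ≤ 8 * μ * θ / ρ ^ 2 := by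
  set g : ℝ := ρ ^ 2 / (8 * μ) with hg
  have hg0 : 0 < g := by positivity
  have hgμ : g ≤ μ / 2 := by
    rw [hg, div_le_iff₀ (by positivity)]
    nlinarith
  have hgρ : 8 * μ * g = ρ ^ 2 := by rw [hg]; field_simp
  set v := ∑ j, w j • z j with hvdef
  have hvpos : 0 < ‖v‖ := by linarith
  set e : E := ‖v‖⁻¹ • v with he
  have he1 : ‖e‖ = 1 := by rw [he, norm_smul, norm_inv, norm_norm, inv_mul_cancel₀ hvpos.ne']
  set a : ι → ℝ := fun j => inner ℝ (z j) e with ha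
  have hsum : ∑ j, w j * a j = ‖v‖ := by
    have h1 : inner ℝ v e = ‖v‖ := by
      rw [he, inner_smul_right, real_inner_self_eq_norm_sq]
      field_simp
    rw [← h1, hvdef, sum_inner]
    simp [ha, inner_smul_left]
  have haz : ∀ j, a j ≤ ‖z j‖ := fun j => by
    have := real_inner_le_norm (z j) e
    rwa [he1, mul_one] at this
  have hne : Nonempty ι := by
    by_contra h
    rw [not_nonempty_iff] at h
    simp [hvdef] at hvpos
  -- All is measured along the direction `e` of the combination: the weighted mean of the `a j` is
  -- at least `μ - θ`, so the largest of them is too.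
  obtain ⟨j₀, hj₀⟩ := Finite.exists_max a
  have ha₀ : μ - θ ≤ a j₀ := by
    have h1 : ‖v‖ ≤ (∑ j, w j) * a j₀ := by
      rw [← hsum, Finset.sum_mul]
      exact Finset.sum_le_sum fun j _ => mul_le_mul_of_nonneg_left (hj₀ j) (hw0 j)
    have h2 : 0 ≤ ∑ j, w j := Finset.sum_nonneg fun j _ => hw0 j
    have h3 : 0 ≤ a j₀ := by
      by_contra h
      push Not at h
      nlinarith
    nlinarith
  have hj₀J : j₀ ∉ J := fun h => by
    have := haz j₀
    have := hJ j₀ h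
    linarith
  have hnear : ∀ j, ‖z j - μ • e‖ ^ 2 ≤ 2 * μ * (μ - a j) := fun j => by
    rw [norm_sub_sq_real, inner_smul_right, norm_smul, he1, mul_one, Real.norm_eq_abs, sq_abs]
    have := hz j
    have := norm_nonneg (z j)
    change _ - 2 * (μ * a j) + _ ≤ _
    nlinarith
  -- Two vectors of the ball that both reach far along `e` are both near `μ • e`, hence near each
  -- other. With `8 * μ * g = ρ ^ 2` and `θ < g` this would contradict the separation.
  have hgap : ∀ j, j ≠ j₀ → a j ≤ μ - g := fun j hj => by
    by_cases hjJ : j ∈ J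
    · have := haz j
      have := hJ j hjJ
      linarith
    · have h1 := hsep j hjJ j₀ hj₀J hj
      have h2 : ‖z j - z j₀‖ ^ 2 ≤ 2 * ‖z j - μ • e‖ ^ 2 + 2 * ‖z j₀ - μ • e‖ ^ 2 := by
        have h3 : z j - z j₀ = (z j - μ • e) - (z j₀ - μ • e) := by abel
        have h4 := norm_sub_le (z j - μ • e) (z j₀ - μ • e)
        rw [← h3] at h4
        nlinarith [norm_nonneg (z j - z j₀), sq_nonneg (‖z j - μ • e‖ - ‖z j₀ - μ • e‖)]
      have h3 := hnear j
      have h4 := hnear j₀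
      have h5 : ρ ^ 2 ≤ ‖z j - z j₀‖ ^ 2 := pow_le_pow_left₀ hρ.le h1 2
      by_contra h
      push Not at h
      nlinarith
  refine ⟨j₀, hj₀J, ?_⟩
  have hbound : ‖v‖ ≤ μ - g * (1 - w j₀) := by
    rw [← hsum, ← Finset.add_sum_erase _ _ (Finset.mem_univ j₀)]
    rw [← Finset.add_sum_erase _ _ (Finset.mem_univ j₀)] at hw1
    have h1 : ∑ j ∈ Finset.univ.erase j₀, w j * a j
        ≤ (∑ j ∈ Finset.univ.erase j₀, w j) * (μ - g) := by
      rw [Finset.sum_mul]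
      exact Finset.sum_le_sum fun j hj =>
        mul_le_mul_of_nonneg_left (hgap j (Finset.ne_of_mem_erase hj)) (hw0 j)
    have h2 : w j₀ * a j₀ ≤ w j₀ * μ :=
      mul_le_mul_of_nonneg_left ((haz j₀).trans (hz j₀)) (hw0 j₀)
    nlinarith
  rw [le_div_iff₀ (by positivity), ← hgρ]
  nlinarith

lemma sum_abs_le_sqrt_mul_norm {r : ℕ} (y : EuclideanSpace ℝ (Fin r)) :
    ∑ j, |y j| ≤ √r * ‖y‖ := by
  rw [EuclideanSpace.norm_eq, ← Real.sqrt_mul (by positivity)]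
  apply Real.le_sqrt_of_sq_le
  simpa using sq_sum_le_card_mul_sum_sq (s := Finset.univ) (f := fun j => |y j|)

/-- The part of `x` outside the span of a perturbed set of unit vectors is not small when `x` is
supported outside the corresponding coordinates. -/
lemma half_norm_le_norm_sub_sum {r : ℕ} {J : Finset (Fin r)} {x : EuclideanSpace ℝ (Fin r)}
    (hx : ∀ j ∈ J, x j = 0) (q : Fin r → EuclideanSpace ℝ (Fin r)) {β : ℝ} (hβ : 0 ≤ β)
    (hq : ∀ j ∈ J, ‖q j - EuclideanSpace.single j 1‖ ≤ β) (hβr : β * √r ≤ 1 / 2) (y : Fin r → ℝ) :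
    ‖x‖ / 2 ≤ ‖x - ∑ j ∈ J, y j • q j‖ := by
  set Y : EuclideanSpace ℝ (Fin r) := WithLp.toLp 2 (fun j => if j ∈ J then y j else 0) with hY
  have hYs : Y = ∑ j ∈ J, y j • EuclideanSpace.single j (1 : ℝ) := by
    ext k
    simp [hY, Finset.sum_apply, Pi.single_apply]
  have hdec : x - ∑ j ∈ J, y j • q j
      = (x - Y) - ∑ j ∈ J, y j • (q j - EuclideanSpace.single j (1 : ℝ)) := by
    simp only [smul_sub, Finset.sum_sub_distrib, hYs]
    abel
  have hsmall : ‖∑ j ∈ J, y j • (q j - EuclideanSpace.single j (1 : ℝ))‖ ≤ ‖Y‖ / 2 := by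
    calc ‖∑ j ∈ J, y j • (q j - EuclideanSpace.single j (1 : ℝ))‖
        ≤ ∑ j ∈ J, |y j| * β := by
          refine norm_sum_le_of_le _ fun j hj => ?_
          rw [norm_smul, Real.norm_eq_abs]
          exact mul_le_mul_of_nonneg_left (hq j hj) (abs_nonneg _)
      _ = (∑ j, |Y j|) * β := by
          rw [← Finset.sum_mul]
          congr 1
          simp [hY, apply_ite abs, Finset.sum_ite_mem]
      _ ≤ √r * ‖Y‖ * β := mul_le_mul_of_nonneg_right (sum_abs_le_sqrt_mul_norm Y) hβ
      _ ≤ ‖Y‖ / 2 := by nlinarith [norm_nonneg Y]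
  -- The supports are disjoint, so `‖x - Y‖` dominates both `‖x‖` and `‖Y‖`; the perturbation, at
  -- most `‖Y‖ / 2`, then costs at most half.
  have horth : inner ℝ x Y = 0 := by
    simp only [PiLp.inner_apply, hY]
    refine Finset.sum_eq_zero fun j _ => ?_
    by_cases hj : j ∈ J <;> simp [hj, hx]
  have hpyth : ‖x - Y‖ ^ 2 = ‖x‖ ^ 2 + ‖Y‖ ^ 2 := by
    rw [norm_sub_sq_real, horth]
    ring
  have h1 : ‖Y‖ ≤ ‖x - Y‖ := by
    apply le_of_sq_le_sq _ (norm_nonneg _)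
    nlinarith [norm_nonneg x]
  have h2 : ‖x‖ ≤ ‖x - Y‖ := by
    apply le_of_sq_le_sq _ (norm_nonneg _)
    nlinarith [norm_nonneg Y]
  rw [hdec]
  have h3 := norm_sub_norm_le (x - Y) (∑ j ∈ J, y j • (q j - EuclideanSpace.single j (1 : ℝ)))
  linarith

/-- The 2-norm is at most the 1-norm, and both the deficit at `j` and the total of the other weights
are at most `1 - w j`. -/
lemma norm_sub_single_le {r : ℕ} (w : EuclideanSpace ℝ (Fin r)) (hw0 : ∀ j, 0 ≤ w j)
    (hw1 : ∑ j, w j ≤ 1) (j : Fin r) :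
    ‖w - EuclideanSpace.single j 1‖ ≤ 2 * (1 - w j) := by
  have hle : ∀ x : EuclideanSpace ℝ (Fin r), ‖x‖ ≤ ∑ k, |x k| := fun x => by
    rw [EuclideanSpace.norm_eq]
    refine Real.sqrt_le_iff.mpr ⟨by positivity, ?_⟩
    simpa using Finset.sum_sq_le_sq_sum_of_nonneg (s := Finset.univ) (f := fun k => |x k|)
      (fun _ _ => abs_nonneg _)
  refine (hle _).trans ?_
  rw [← Finset.add_sum_erase _ _ (Finset.mem_univ j)] at hw1 ⊢
  have hwj : w j ≤ 1 := by
    have : 0 ≤ ∑ k ∈ Finset.univ.erase j, w k := Finset.sum_nonneg fun k _ => hw0 k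
    linarith
  have h1 : ∑ k ∈ Finset.univ.erase j, |(w - EuclideanSpace.single j (1 : ℝ)) k|
      = ∑ k ∈ Finset.univ.erase j, w k := by
    refine Finset.sum_congr rfl fun k hk => ?_
    simp [Finset.ne_of_mem_erase hk, abs_of_nonneg (hw0 k)]
  rw [h1]
  have h2 : |(w - EuclideanSpace.single j (1 : ℝ)) j| = 1 - w j := by
    simp [abs_sub_comm (w j) 1, abs_of_nonneg (sub_nonneg.mpr hwj)]
  rw [h2]
  linarith

lemma col_mul {n d m : ℕ} (M : Matrix (Fin n) (Fin d) ℝ) (S : Matrix (Fin d) (Fin m) ℝ)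
    (i : Fin m) : col (M * S) i = toEuclideanLin M (col S i) := by
  ext a
  simp [col, Matrix.mul_apply, mulVec, dotProduct]

lemma col_projectOut {d m : ℕ} (S : Matrix (Fin d) (Fin m) ℝ) (i k : Fin m) :
    col (projectOut S i) k =
      col S k - ((‖col S i‖ ^ 2)⁻¹ * inner ℝ (col S i) (col S k)) • col S i := by
  ext a
  simp only [projectOut, col_mul, toLpLin_apply, Matrix.sub_mulVec, Matrix.one_mulVec,
    Matrix.smul_mulVec, vecMulVec_mulVec]
  simp [col, PiLp.inner_apply, dotProduct, mul_comm]
  ring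

/-- One step of the successive projection algorithm: a column of maximal norm of the projected
matrix is close to a new vertex. -/
lemma exists_vertex_of_pivot {n m r : ℕ}
    (H : EuclideanSpace ℝ (Fin r) →ₗ[ℝ] EuclideanSpace ℝ (Fin n))
    (hHl : ∀ x, ‖x‖ / 2 ≤ ‖H x‖) (hHu : ∀ x, ‖H x‖ ≤ 2 * ‖x‖)
    (w q : Fin m → EuclideanSpace ℝ (Fin r)) (hw0 : ∀ i j, 0 ≤ w i j) (hw1 : ∀ i, ∑ j, w i j ≤ 1)
    {δ : ℝ} (hδ0 : 0 ≤ δ) (hδ : δ * √r ≤ 1 / 40000) (hq : ∀ i, ‖q i - w i‖ ≤ δ)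
    (hvert : ∀ j, ∃ i, w i = EuclideanSpace.single j 1)
    (T : EuclideanSpace ℝ (Fin n) →ₗ[ℝ] EuclideanSpace ℝ (Fin n)) (hT : ∀ x, ‖T x‖ ≤ ‖x‖)
    (J : Finset (Fin r)) (idx : Fin r → Fin m) (hT0 : ∀ j ∈ J, T (H (q (idx j))) = 0)
    (hTs : ∀ x, x - T x ∈ Submodule.span ℝ ((fun j => H (q (idx j))) '' (J : Set (Fin r))))
    (hJ : ∀ j ∈ J, ‖q (idx j) - EuclideanSpace.single j 1‖ ≤ 2049 * δ) (hJne : ∃ j, j ∉ J)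
    (i : Fin m) (hi : ∀ k, ‖T (H (q k))‖ ≤ ‖T (H (q i))‖) :
    T (H (q i)) ≠ 0 ∧ ∃ j, j ∉ J ∧ ‖q i - EuclideanSpace.single j 1‖ ≤ 2049 * δ := by
  obtain ⟨j', hj'⟩ := hJne
  have hr1 : 1 ≤ √(r : ℝ) := by
    rw [Real.one_le_sqrt]
    exact_mod_cast j'.pos
  have hδ1 : δ ≤ 1 / 40000 := by nlinarith
  -- `T` only subtracts combinations of the chosen columns. One factor `1/2` is lost to their
  -- perturbation, the other to the lower bound on `H`.
  have hres : ∀ x : EuclideanSpace ℝ (Fin r), (∀ j ∈ J, x j = 0) → ‖x‖ / 4 ≤ ‖T (H x)‖ := by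
    intro x hx
    obtain ⟨y, hy⟩ := Submodule.mem_span_image_finset_iff_exists_fun' ℝ |>.mp (hTs (H x))
    have h1 : T (H x) = H (x - ∑ j ∈ J, y j • q (idx j)) := by
      rw [map_sub, map_sum]
      simp only [map_smul]
      rw [hy]
      abel
    have h2 := half_norm_le_norm_sub_sum hx (fun j => q (idx j)) (β := 2049 * δ) (by positivity)
      hJ (by nlinarith) y
    have h3 := hHl (x - ∑ j ∈ J, y j • q (idx j))
    rw [h1]
    linarith
  have hTH : ∀ x, ‖T (H x)‖ ≤ 2 * ‖x‖ := fun x => (hT _).trans (hHu x)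
  set z : Fin r → EuclideanSpace ℝ (Fin n) := fun j => T (H (EuclideanSpace.single j 1)) with hz
  have hTw : ∀ k, ‖T (H (q k)) - ∑ j, w k j • z j‖ ≤ 2 * δ := by
    intro k
    have h1 : ∑ j, w k j • z j = T (H (w k)) := by
      have h2 : w k = ∑ j, w k j • EuclideanSpace.single j (1 : ℝ) := by
        ext l
        simp [Finset.sum_apply, Pi.single_apply]
      conv_rhs => rw [h2]
      simp [hz]
    rw [h1, ← map_sub, ← map_sub]
    have := hTH (q k - w k)
    have := hq k
    linarith
  obtain ⟨j₁, hj₁, hmax⟩ := Finset.exists_max_image Jᶜ (fun j => ‖z j‖)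
    ⟨j', Finset.mem_compl.mpr hj'⟩
  rw [Finset.mem_compl] at hj₁
  have hμl : 1 / 4 ≤ ‖z j₁‖ := by
    have := hres (EuclideanSpace.single j₁ 1) (fun j hj => by
      simp [ne_of_mem_of_not_mem hj hj₁])
    simpa [PiLp.norm_single] using this
  have hμu : ‖z j₁‖ ≤ 2 := by
    have := hTH (EuclideanSpace.single j₁ 1)
    simpa [PiLp.norm_single] using this
  have hzJ : ∀ j ∈ J, ‖z j‖ ≤ ‖z j₁‖ / 2 := by
    intro j hj
    have h1 : z j = - T (H (q (idx j) - EuclideanSpace.single j 1)) := by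
      rw [map_sub, map_sub, hT0 j hj, zero_sub, neg_neg]
    have h2 := hTH (q (idx j) - EuclideanSpace.single j 1)
    have h3 := hJ j hj
    rw [h1, norm_neg]
    linarith
  have hzle : ∀ j, ‖z j‖ ≤ ‖z j₁‖ := fun j => by
    by_cases hj : j ∈ J
    · have := hzJ j hj
      linarith
    · exact hmax j (Finset.mem_compl.mpr hj)
  have hsep : ∀ j, j ∉ J → ∀ l, l ∉ J → j ≠ l → 1 / 4 ≤ ‖z j - z l‖ := by
    intro j hj l hl hjl
    have h1 := hres (EuclideanSpace.single j 1 - EuclideanSpace.single l 1) (fun k hk => by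
      simp [ne_of_mem_of_not_mem hk hj, ne_of_mem_of_not_mem hk hl])
    have h2 := PiLp.norm_apply_le
      (EuclideanSpace.single j (1 : ℝ) - EuclideanSpace.single l (1 : ℝ)) j
    simp only [PiLp.sub_apply, PiLp.single_apply, if_true, hjl, if_false, sub_zero,
      norm_one] at h2
    rw [map_sub, map_sub] at h1
    linarith
  obtain ⟨i₁, hi₁⟩ := hvert j₁
  have hlarge : ‖z j₁‖ - 2 * δ ≤ ‖T (H (q i))‖ := by
    have h1 := hTw i₁
    have h2 : ∑ j, w i₁ j • z j = z j₁ := by simp [hi₁, ite_smul]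
    rw [h2] at h1
    have h3 := norm_sub_norm_le (z j₁) (T (H (q i₁)))
    rw [norm_sub_rev] at h3
    have := hi i₁
    linarith
  refine ⟨fun h => ?_, ?_⟩
  · rw [h, norm_zero] at hlarge
    linarith
  -- The pivot beats the column at vertex `j₁`, which loses `2 * δ`; replacing `q i` by `w i` loses
  -- `2 * δ` more.
  have hv : ‖z j₁‖ - 4 * δ ≤ ‖∑ j, w i j • z j‖ := by
    have h1 := hTw i
    have h3 := norm_sub_norm_le (T (H (q i))) (∑ j, w i j • z j)
    linarith
  obtain ⟨j, hjJ, hj⟩ := exists_dominant_weight z (w i) J (ρ := 1 / 4) (hw0 i) (hw1 i)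
    (by linarith) hzle hzJ hsep (by norm_num) (by linarith)
    (by rw [lt_div_iff₀ (by linarith)]; nlinarith) hv
  refine ⟨j, hjJ, ?_⟩
  -- `8 * μ * θ / ρ ^ 2` with `μ ≤ 2`, `θ = 4 * δ`, `ρ = 1 / 4`. Doubling and adding `‖q i - w i‖ ≤
  -- δ` gives `2049 * δ`.
  have h1 : 1 - w i j ≤ 1024 * δ := by
    refine hj.trans ?_
    rw [div_le_iff₀ (by norm_num)]
    nlinarith
  have h2 := norm_sub_single_le (w i) (hw0 i) (hw1 i) j
  have h3 := norm_sub_le_norm_sub_add_norm_sub (q i) (w i) (EuclideanSpace.single j 1)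
  have h4 := hq i
  linarith

/-- Robustness of the successive projection algorithm for a well-conditioned factor. -/
theorem spaReturns_of_wellConditioned {n m r : ℕ} (S : Matrix (Fin n) (Fin m) ℝ)
    (H : EuclideanSpace ℝ (Fin r) →ₗ[ℝ] EuclideanSpace ℝ (Fin n))
    (hHl : ∀ x, ‖x‖ / 2 ≤ ‖H x‖) (hHu : ∀ x, ‖H x‖ ≤ 2 * ‖x‖)
    (w q : Fin m → EuclideanSpace ℝ (Fin r)) (hw0 : ∀ i j, 0 ≤ w i j) (hw1 : ∀ i, ∑ j, w i j ≤ 1)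
    {δ : ℝ} (hδ0 : 0 ≤ δ) (hδ : δ * √r ≤ 1 / 40000) (hq : ∀ i, ‖q i - w i‖ ≤ δ)
    (hvert : ∀ j, ∃ i, w i = EuclideanSpace.single j 1) (hS : ∀ i, col S i = H (q i)) :
    SPAReturns S r (fun I => ∃ idx : Fin r → Fin m, Function.Injective idx ∧
      Finset.univ.image idx = I ∧ ∀ j, ‖q (idx j) - EuclideanSpace.single j 1‖ ≤ 2049 * δ) := by
  set Q : Finset (Fin m) → Prop := fun I => ∃ idx : Fin r → Fin m, Function.Injective idx ∧
      Finset.univ.image idx = I ∧ ∀ j, ‖q (idx j) - EuclideanSpace.single j 1‖ ≤ 2049 * δ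
  -- Induction on the number `k` of steps left. `J` holds the vertices found, `idx` their columns,
  -- and `T` the accumulated projection. Only three properties of `T` are kept: it is a contraction,
  -- it kills the chosen columns, and it moves vectors within their span.
  have key : ∀ (k : ℕ) (S' : Matrix (Fin n) (Fin m) ℝ)
      (T : EuclideanSpace ℝ (Fin n) →ₗ[ℝ] EuclideanSpace ℝ (Fin n)) (J : Finset (Fin r))
      (idx : Fin r → Fin m), k + J.card = r → (∀ i, col S' i = T (H (q i))) →
      (∀ x, ‖T x‖ ≤ ‖x‖) → Set.InjOn idx J → (∀ j ∈ J, T (H (q (idx j))) = 0) →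
      (∀ x, x - T x ∈ Submodule.span ℝ ((fun j => H (q (idx j))) '' (J : Set (Fin r)))) →
      (∀ j ∈ J, ‖q (idx j) - EuclideanSpace.single j 1‖ ≤ 2049 * δ) →
      SPALoop r Q S' (J.image idx) := by
    intro k
    induction k with
    | zero =>
      intro S' T J idx hk hS' hT hinj hT0 hTs hJ
      have hJu : J = Finset.univ := by
        rw [← Finset.card_eq_iff_eq_univ, Fintype.card_fin]
        omega
      refine SPALoop.halt ?_ ⟨idx, ?_, by rw [hJu], fun j => hJ j (by simp [hJu])⟩
      · rw [Finset.card_image_of_injOn hinj]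
        omega
      · rw [hJu, Finset.coe_univ] at hinj
        exact Set.injOn_univ.mp hinj
    | succ k ih =>
      intro S' T J idx hk hS' hT hinj hT0 hTs hJ
      have hJne : ∃ j, j ∉ J := by
        by_contra! h
        have h1 := (Finset.eq_univ_iff_forall.mpr h)
        rw [h1, Finset.card_univ, Fintype.card_fin] at hk
        omega
      have hpiv : ∀ i, IsPivot S' i → T (H (q i)) ≠ 0 ∧
          ∃ j, j ∉ J ∧ ‖q i - EuclideanSpace.single j 1‖ ≤ 2049 * δ := fun i hi =>
        exists_vertex_of_pivot H hHl hHu w q hw0 hw1 hδ0 hδ hq hvert T hT J idx hT0 hTs hJ hJne i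
          fun l => by
            have := hi l
            rw [hS', hS'] at this
            exact le_of_sq_le_sq this (norm_nonneg _)
      refine SPALoop.step ?_ ?_ ?_ ?_
      · rw [Finset.card_image_of_injOn hinj]
        omega
      · obtain ⟨j, -⟩ := hJne
        obtain ⟨i, -⟩ := hvert j
        have : Nonempty (Fin m) := ⟨i⟩
        exact Finite.exists_max fun l => ‖col S' l‖ ^ 2
      · intro i hi
        rw [hS']
        exact (hpiv i hi).1
      · intro i hi
        obtain ⟨ht, j, hjJ, hj⟩ := hpiv i hi
        set t := T (H (q i)) with htdef
        have htpos : 0 < ‖t‖ ^ 2 := by positivity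
        set T' : EuclideanSpace ℝ (Fin n) →ₗ[ℝ] EuclideanSpace ℝ (Fin n) :=
          T - ((‖t‖ ^ 2)⁻¹ • (innerₛₗ ℝ t) ∘ₗ T).smulRight t with hT'
        have hT'a : ∀ x, T' x = T x - ((‖t‖ ^ 2)⁻¹ * inner ℝ t (T x)) • t := fun x => by
          simp [hT']
        have hnew : ∀ l ∈ J, Function.update idx j i l = idx l := fun l hl =>
          Function.update_of_ne (ne_of_mem_of_not_mem hl hjJ) _ _
        -- Chosen columns have zero residual and the pivot does not, so no index is repeated and the
        -- cardinality really grows.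
        have hiJ : i ∉ J.image idx := fun h => by
          obtain ⟨l, hl, rfl⟩ := Finset.mem_image.mp h
          exact ht (hT0 l hl)
        have himage : (insert j J).image (Function.update idx j i) = insert i (J.image idx) := by
          rw [Finset.image_insert, Function.update_self]
          congr 1
          exact Finset.image_congr hnew
        rw [← himage]
        have hTi : T' (H (q i)) = 0 := by
          rw [hT'a, ← htdef, real_inner_self_eq_norm_sq, inv_mul_cancel₀ htpos.ne', one_smul,
            sub_self]
        have hspan : Submodule.span ℝ ((fun j => H (q (idx j))) '' (J : Set (Fin r))) ≤
            Submodule.span ℝ ((fun l => H (q (Function.update idx j i l))) ''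
              ((insert j J : Finset (Fin r)) : Set (Fin r))) := by
          apply Submodule.span_mono
          rintro _ ⟨l, hl, rfl⟩
          exact ⟨l, by simp [Finset.mem_coe.mp hl], by simp only [hnew l hl]⟩
        refine ih _ T' _ _ ?_ ?_ ?_ ?_ ?_ ?_ ?_
        · rw [Finset.card_insert_of_notMem hjJ]
          omega
        · intro l
          rw [col_projectOut, hS', hS', hT'a]
        · intro x
          refine le_trans ?_ (hT x)
          apply le_of_sq_le_sq _ (norm_nonneg _)
          rw [hT'a, norm_sub_sq_real, inner_smul_right, norm_smul, mul_pow, Real.norm_eq_abs,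
            sq_abs, real_inner_comm t (T x)]
          have h1 : ((‖t‖ ^ 2)⁻¹ * inner ℝ t (T x)) ^ 2 * ‖t‖ ^ 2
              = (‖t‖ ^ 2)⁻¹ * inner ℝ t (T x) * inner ℝ t (T x) := by
            field_simp
          have h2 : 0 ≤ (‖t‖ ^ 2)⁻¹ * inner ℝ t (T x) * inner ℝ t (T x) := by
            rw [mul_assoc]
            exact mul_nonneg (by positivity) (mul_self_nonneg _)
          rw [h1]
          linarith
        · rw [Finset.coe_insert, Set.injOn_insert (by simpa using hjJ)]
          refine ⟨fun a ha b hb hab => hinj ha hb ?_, ?_⟩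
          · rwa [hnew a ha, hnew b hb] at hab
          · rintro ⟨l, hl, hle⟩
            rw [hnew l hl, Function.update_self] at hle
            exact hiJ (Finset.mem_image.mpr ⟨l, hl, hle⟩)
        · intro l hl
          rcases Finset.mem_insert.mp hl with rfl | hl
          · rw [Function.update_self, hTi]
          · rw [hnew l hl, hT'a, hT0 l hl]
            simp
        · intro x
          have h1 : x - T' x = (x - T x) + ((‖t‖ ^ 2)⁻¹ * inner ℝ t (T x)) • t := by
            rw [hT'a]
            abel
          have h2 : t = H (q i) - (H (q i) - T (H (q i))) := by rw [htdef]; abel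
          have h3 : H (q i) ∈ Submodule.span ℝ ((fun l => H (q (Function.update idx j i l))) ''
              ((insert j J : Finset (Fin r)) : Set (Fin r))) :=
            Submodule.subset_span ⟨j, by simp, by simp⟩
          rw [h1]
          refine Submodule.add_mem _ (hspan (hTs x)) (Submodule.smul_mem _ _ ?_)
          rw [h2]
          exact Submodule.sub_mem _ h3 (hspan (hTs _))
        · intro l hl
          rcases Finset.mem_insert.mp hl with rfl | hl
          · rw [Function.update_self]
            exact hj
          · rw [hnew l hl]
            exact hJ l hl
  -- For `J = ∅` the initial `idx` is arbitrary.
  have := key r S LinearMap.id ∅ (fun j => (hvert j).choose) (by simp) (by simpa using hS)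
    (by simp) (by simp) (by simp) (by simp) (by simp)
  simpa [SPAReturns] using this

/-! ### Trace and determinant estimates -/

lemma inner_map_self_eq_sum {ι E : Type*} [Fintype ι] [NormedAddCommGroup E]
    [InnerProductSpace ℝ E] (b : OrthonormalBasis ι ℝ E) (T : E →ₗ[ℝ] E) (lam : ι → ℝ)
    (hb : ∀ i, T (b i) = lam i • b i) (x : E) :
    inner ℝ x (T x) = ∑ i, lam i * inner ℝ (b i) x ^ 2 := by
  have h1 : T x = ∑ i, (inner ℝ (b i) x * lam i) • b i := by
    conv_lhs => rw [← b.sum_repr' x]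
    simp [hb, smul_smul]
  rw [h1, inner_sum]
  refine Finset.sum_congr rfl fun i _ => ?_
  rw [inner_smul_right, real_inner_comm]
  ring

lemma norm_sq_eq_sum {ι E : Type*} [Fintype ι] [NormedAddCommGroup E]
    [InnerProductSpace ℝ E] (b : OrthonormalBasis ι ℝ E) (x : E) :
    ‖x‖ ^ 2 = ∑ i, inner ℝ (b i) x ^ 2 := by
  have := inner_map_self_eq_sum b LinearMap.id (fun _ => 1) (by simp) x
  simpa using this

/-- `x - 1 - log x` is convex with minimum `0` at `1`; its value is `log 2 - 1/2 ≈ 0.193` at `1/2`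
and `1 - log 2 ≈ 0.307` at `2`, whence the threshold `19/100`. -/
lemma half_le_and_le_two_of_sub_log_le {x : ℝ} (hx : 0 < x)
    (h : x - 1 - Real.log x ≤ 19 / 100) : 1 / 2 ≤ x ∧ x ≤ 2 := by
  have hl := Real.log_two_gt_d9
  have hu := Real.log_two_lt_d9
  constructor
  · by_contra! hlt
    have h1 := Real.log_le_sub_one_of_pos (x := 2 * x) (by positivity)
    rw [Real.log_mul (by norm_num) hx.ne'] at h1
    linarith
  · by_contra! hlt
    have h1 := Real.log_le_sub_one_of_pos (x := x / 2) (by positivity)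
    rw [Real.log_div hx.ne' (by norm_num)] at h1
    linarith

/-- A positive definite matrix whose trace and determinant almost attain equality in the inequality
`log det Q ≤ tr Q - r` is well-conditioned. -/
lemma quadratic_bounds_of_trace_sub_log_det_le {r : ℕ} {Q : Matrix (Fin r) (Fin r) ℝ}
    (hQ : Q.PosDef) (h : Q.trace - r - Real.log Q.det ≤ 19 / 100) (x : EuclideanSpace ℝ (Fin r)) :
    ‖x‖ ^ 2 / 2 ≤ inner ℝ x (toEuclideanLin Q x) ∧
      inner ℝ x (toEuclideanLin Q x) ≤ 2 * ‖x‖ ^ 2 := by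
  set lam := hQ.1.eigenvalues
  have hpos : ∀ i, 0 < lam i := hQ.eigenvalues_pos
  have htr : Q.trace = ∑ i, lam i := by simpa using hQ.1.trace_eq_sum_eigenvalues
  have hdet : Real.log Q.det = ∑ i, Real.log (lam i) := by
    have : Q.det = ∏ i, lam i := by simpa using hQ.1.det_eq_prod_eigenvalues
    rw [this, Real.log_prod fun i _ => (hpos i).ne']
  have hsum : ∑ i, (lam i - 1 - Real.log (lam i)) ≤ 19 / 100 := by
    simpa [Finset.sum_sub_distrib, htr, hdet] using h
  have hb : ∀ i, 1 / 2 ≤ lam i ∧ lam i ≤ 2 := fun i => by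
    refine half_le_and_le_two_of_sub_log_le (hpos i) (le_trans ?_ hsum)
    refine Finset.single_le_sum (f := fun i => lam i - 1 - Real.log (lam i)) (fun j _ => ?_)
      (Finset.mem_univ i)
    have := Real.log_le_sub_one_of_pos (hpos j)
    linarith
  rw [inner_map_self_eq_sum hQ.1.eigenvectorBasis (toEuclideanLin Q) lam (fun i => by
    rw [toLpLin_apply, hQ.1.mulVec_eigenvectorBasis]; rfl) x,
    norm_sq_eq_sum hQ.1.eigenvectorBasis x, Finset.sum_div, Finset.mul_sum]
  constructor
  · refine Finset.sum_le_sum fun i _ => ?_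
    nlinarith [(hb i).1, sq_nonneg (inner ℝ (hQ.1.eigenvectorBasis i) x)]
  · refine Finset.sum_le_sum fun i _ => ?_
    nlinarith [(hb i).2, sq_nonneg (inner ℝ (hQ.1.eigenvectorBasis i) x)]

lemma norm_map_le_sqrt_sum {n r : ℕ}
    (H : EuclideanSpace ℝ (Fin r) →ₗ[ℝ] EuclideanSpace ℝ (Fin n)) (x : EuclideanSpace ℝ (Fin r)) :
    ‖H x‖ ≤ √(∑ k, ‖H (EuclideanSpace.single k 1)‖ ^ 2) * ‖x‖ := by
  have h2 : x = ∑ j, x j • EuclideanSpace.single j (1 : ℝ) := by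
    ext l
    simp [Finset.sum_apply, Pi.single_apply]
  calc ‖H x‖ = ‖∑ j, x j • H (EuclideanSpace.single j (1 : ℝ))‖ := by
        conv_lhs => rw [h2]
        simp
    _ ≤ ∑ j, ‖H (EuclideanSpace.single j (1 : ℝ))‖ * ‖x j‖ :=
        norm_sum_le_of_le _ fun j _ => by rw [norm_smul, mul_comm]
    _ ≤ _ := by
        rw [EuclideanSpace.norm_eq]
        exact Real.sum_mul_le_sqrt_mul_sqrt _ _ _

/-- A linear map that sends perturbed unit vectors into the unit ball has squared Frobenius norm
at most slightly larger than `r`. -/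
lemma sum_norm_sq_le_of_perturbed {n r : ℕ}
    (H : EuclideanSpace ℝ (Fin r) →ₗ[ℝ] EuclideanSpace ℝ (Fin n))
    (q : Fin r → EuclideanSpace ℝ (Fin r)) {δ : ℝ} (hδ0 : 0 ≤ δ) (hδ : δ * (r * √r) ≤ 1 / 40000)
    (hq : ∀ k, ‖q k - EuclideanSpace.single k 1‖ ≤ δ) (hH : ∀ k, ‖H (q k)‖ ≤ 1) :
    ∑ k, ‖H (EuclideanSpace.single k 1)‖ ^ 2 ≤ r + 1 / 10000 := by
  rcases Nat.eq_zero_or_pos r with rfl | hr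
  · simp
  have hr1 : (1 : ℝ) ≤ r := by exact_mod_cast hr
  set t := √(∑ k, ‖H (EuclideanSpace.single k 1)‖ ^ 2) with ht
  have ht0 : 0 ≤ t := Real.sqrt_nonneg _
  have ht2 : t ^ 2 = ∑ k, ‖H (EuclideanSpace.single k 1)‖ ^ 2 := Real.sq_sqrt (by positivity)
  have hs0 : 0 ≤ √(r : ℝ) := Real.sqrt_nonneg _
  have hs2 : √(r : ℝ) ^ 2 = r := Real.sq_sqrt (by positivity)
  have hcol : ∀ k, ‖H (EuclideanSpace.single k 1)‖ ≤ 1 + t * δ := fun k => by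
    have h1 : H (EuclideanSpace.single k 1) = H (q k) - H (q k - EuclideanSpace.single k 1) := by
      rw [map_sub]; abel
    have h2 := norm_sub_le (H (q k)) (H (q k - EuclideanSpace.single k 1))
    have h3 := norm_map_le_sqrt_sum H (q k - EuclideanSpace.single k 1)
    have h4 := mul_le_mul_of_nonneg_left (hq k) ht0
    rw [h1]
    linarith [hH k]
  have h1 : t ^ 2 ≤ (√r * (1 + t * δ)) ^ 2 := by
    rw [ht2, mul_pow, hs2]
    calc _ ≤ ∑ _k : Fin r, (1 + t * δ) ^ 2 :=
          Finset.sum_le_sum fun k _ => pow_le_pow_left₀ (norm_nonneg _) (hcol k) 2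
      _ = _ := by simp
  -- The Frobenius norm `t` bounds itself: `t * (1 - τ) ≤ √r`. Since `(1 - τ)⁻² ≤ 1 + 4 * τ` here,
  -- the excess of `t ^ 2` over `r` is at most `4 * r * τ ≤ 1 / 10000`.
  have h2 : t ≤ √r * (1 + t * δ) := le_of_sq_le_sq h1 (by positivity)
  set τ := √r * δ with hτ
  have hτ0 : 0 ≤ τ := by positivity
  have hrτ : r * τ ≤ 1 / 40000 := by rw [hτ]; linarith
  have hτ1 : τ ≤ 1 / 40000 := by nlinarith
  have h3 : t * (1 - τ) ≤ √r := by rw [hτ]; linarith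
  have h4 : (t * (1 - τ)) ^ 2 ≤ r := by
    rw [← hs2]
    exact pow_le_pow_left₀ (mul_nonneg ht0 (by linarith)) h3 2
  have h5 : t ^ 2 * ((1 - τ) ^ 2 * (1 + 4 * τ)) ≤ r * (1 + 4 * τ) := by
    have := mul_le_mul_of_nonneg_right h4 (show 0 ≤ 1 + 4 * τ by linarith)
    linarith
  have h6 : 1 ≤ (1 - τ) ^ 2 * (1 + 4 * τ) := by nlinarith [pow_nonneg hτ0 3]
  have h7 : t ^ 2 ≤ t ^ 2 * ((1 - τ) ^ 2 * (1 + 4 * τ)) := le_mul_of_one_le_right (sq_nonneg t) h6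
  rw [← ht2]
  linarith

/-! ### The ellipsoid problem -/

lemma norm_sq_toEuclideanLin {n r : ℕ} (B : Matrix (Fin n) (Fin r) ℝ) (x : Fin r → ℝ) :
    ‖toEuclideanLin B (WithLp.toLp 2 x)‖ ^ 2 = x ⬝ᵥ (Bᵀ * B) *ᵥ x := by
  rw [← mulVec_mulVec, dotProduct_mulVec, vecMul_transpose, EuclideanSpace.norm_sq_eq]
  simp [toLpLin_apply, dotProduct, sq]

lemma trace_transpose_mul_self {n r : ℕ} (B : Matrix (Fin n) (Fin r) ℝ) :
    (Bᵀ * B).trace = ∑ k, ‖toEuclideanLin B (EuclideanSpace.single k 1)‖ ^ 2 := by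
  refine Finset.sum_congr rfl fun k _ => ?_
  rw [EuclideanSpace.norm_sq_eq]
  simp [Matrix.mul_apply, toLpLin_apply, sq]

open scoped MatrixOrder in
lemma transpose_sqrt_mul_sqrt {r : ℕ} {L : Matrix (Fin r) (Fin r) ℝ} (hL : L.PosSemidef) :
    (CFC.sqrt L)ᵀ * CFC.sqrt L = L := by
  have h1 : (CFC.sqrt L).PosSemidef := Matrix.nonneg_iff_posSemidef.mp (CFC.sqrt_nonneg L)
  have h2 : (CFC.sqrt L)ᵀ = CFC.sqrt L := by simpa using h1.1.eq
  rw [h2, CFC.sqrt_mul_sqrt_self L (Matrix.nonneg_iff_posSemidef.mpr hL)]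

lemma feasible_iff_norm_le {r m : ℕ} {P : Matrix (Fin r) (Fin m) ℝ} {B : Matrix (Fin r) (Fin r) ℝ}
    (i : Fin m) : (fun a => P a i) ⬝ᵥ (Bᵀ * B) *ᵥ (fun a => P a i) ≤ 1 ↔
      ‖toEuclideanLin B (col P i)‖ ≤ 1 := by
  rw [← norm_sq_toEuclideanLin, sq_le_one_iff₀ (norm_nonneg _)]
  rfl

lemma toEuclideanLin_mul_apply {a b c : ℕ} (M : Matrix (Fin a) (Fin b) ℝ)
    (N : Matrix (Fin b) (Fin c) ℝ) (x : EuclideanSpace ℝ (Fin c)) :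
    toEuclideanLin (M * N) x = toEuclideanLin M (toEuclideanLin N x) := by
  simp [toLpLin_apply]

lemma trace_le_of_feasible {r m : ℕ} {P : Matrix (Fin r) (Fin m) ℝ} {G : Matrix (Fin r) (Fin r) ℝ}
    {q : Fin m → EuclideanSpace ℝ (Fin r)} (hP : ∀ i, col P i = toEuclideanLin G (q i))
    (ι : Fin r → Fin m) {δ : ℝ} (hδ0 : 0 ≤ δ) (hδ : δ * (r * √r) ≤ 1 / 40000)
    (hq : ∀ k, ‖q (ι k) - EuclideanSpace.single k 1‖ ≤ δ) {B : Matrix (Fin r) (Fin r) ℝ}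
    (hB : ∀ i, (fun a => P a i) ⬝ᵥ (Bᵀ * B) *ᵥ (fun a => P a i) ≤ 1) :
    ((B * G)ᵀ * (B * G)).trace ≤ r + 1 / 10000 := by
  rw [trace_transpose_mul_self]
  refine sum_norm_sq_le_of_perturbed _ (fun k => q (ι k)) hδ0 hδ hq fun k => ?_
  rw [toEuclideanLin_mul_apply, ← hP]
  exact (feasible_iff_norm_le _).mp (hB _)

/-- The competitor in the ellipsoid problem: it undoes `G` and shrinks by the largest norm of the `q
i`. -/
lemma feasible_smul_inv {r m : ℕ} {P : Matrix (Fin r) (Fin m) ℝ} {G : Matrix (Fin r) (Fin r) ℝ}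
    (hG : IsUnit G.det) {q : Fin m → EuclideanSpace ℝ (Fin r)}
    (hP : ∀ i, col P i = toEuclideanLin G (q i)) {s : ℝ} (hs : 0 < s) (hq : ∀ i, ‖q i‖ ≤ s) :
    EllipsoidFeasible P ((s⁻¹ • G⁻¹)ᵀ * (s⁻¹ • G⁻¹)) := by
  have hinv : ∀ x, toEuclideanLin G⁻¹ (toEuclideanLin G x) = x := fun x => by
    rw [← toEuclideanLin_mul_apply, Matrix.nonsing_inv_mul _ hG]
    simp
  refine ⟨?_, fun i => ?_⟩
  · have h1 : ((s⁻¹ • G⁻¹)ᵀ * (s⁻¹ • G⁻¹)).PosSemidef := by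
      simpa using Matrix.posSemidef_conjTranspose_mul_self (s⁻¹ • G⁻¹)
    rw [h1.posDef_iff_det_ne_zero, Matrix.det_mul, Matrix.det_transpose, Matrix.det_smul]
    have h2 : G⁻¹.det ≠ 0 := by
      rw [Matrix.det_nonsing_inv]
      exact (hG.ringInverse).ne_zero
    positivity
  · rw [feasible_iff_norm_le, hP, map_smul, LinearMap.smul_apply, hinv, norm_smul, norm_inv,
      Real.norm_eq_abs, abs_of_pos hs, inv_mul_le_iff₀ hs, mul_one]
    exact hq i

/-- The ellipsoid problem has an optimal solution. -/
lemma exists_ellipsoidOptimal {r m : ℕ} {P : Matrix (Fin r) (Fin m) ℝ}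
    {G : Matrix (Fin r) (Fin r) ℝ} (hG : IsUnit G.det) {q : Fin m → EuclideanSpace ℝ (Fin r)}
    (hP : ∀ i, col P i = toEuclideanLin G (q i))
    (ι : Fin r → Fin m) {δ : ℝ} (hδ0 : 0 ≤ δ) (hδ : δ * (r * √r) ≤ 1 / 40000)
    (hq : ∀ k, ‖q (ι k) - EuclideanSpace.single k 1‖ ≤ δ) {s : ℝ} (hs : 0 < s)
    (hqs : ∀ i, ‖q i‖ ≤ s) : ∃ L, EllipsoidOptimal P L := by
  -- Definiteness is relaxed to semidefiniteness to obtain a closed set; a maximizer of `det` on it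
  -- has positive determinant and so is definite.
  set K : Set (Matrix (Fin r) (Fin r) ℝ) :=
    {L | L.PosSemidef ∧ ∀ i, (fun a => P a i) ⬝ᵥ L *ᵥ (fun a => P a i) ≤ 1} with hK
  have hclosed : IsClosed K := by
    have h1 : K = {L | Lᵀ = L} ∩ (⋂ x : Fin r → ℝ, {L | 0 ≤ x ⬝ᵥ L *ᵥ x}) ∩
        ⋂ i, {L | (fun a => P a i) ⬝ᵥ L *ᵥ (fun a => P a i) ≤ 1} := by
      ext L
      simp [hK, Matrix.posSemidef_iff_dotProduct_mulVec, Matrix.IsHermitian]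
    rw [h1]
    refine IsClosed.inter (IsClosed.inter ?_ ?_) ?_
    · exact isClosed_eq (by fun_prop) continuous_id
    · exact isClosed_iInter fun x => isClosed_le continuous_const (by fun_prop)
    · exact isClosed_iInter fun x => isClosed_le (by fun_prop) continuous_const
  have hcompact : IsCompact K := by
    -- In the coordinates `Gᵀ L G` the trace bound controls every entry, so `K` lies in a linear
    -- image of a box.
    set D : Set (Matrix (Fin r) (Fin r) ℝ) :=
      Set.pi Set.univ fun _ => Set.pi Set.univ fun _ => Set.Icc (-(r + 1 / 10000 : ℝ))
        (r + 1 / 10000) with hD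
    have hDc : IsCompact D :=
      isCompact_univ_pi fun _ => isCompact_univ_pi fun _ => isCompact_Icc
    have hcont : Continuous fun R : Matrix (Fin r) (Fin r) ℝ => (G⁻¹)ᵀ * R * G⁻¹ := by fun_prop
    refine (hDc.image hcont).of_isClosed_subset hclosed fun L hL => ?_
    obtain ⟨B, hB⟩ : ∃ B : Matrix (Fin r) (Fin r) ℝ, Bᵀ * B = L :=
      ⟨_, transpose_sqrt_mul_sqrt hL.1⟩
    refine ⟨(B * G)ᵀ * (B * G), ?_, ?_⟩
    · have htr := trace_le_of_feasible hP ι hδ0 hδ hq (B := B) (by rw [hB]; exact hL.2)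
      rw [trace_transpose_mul_self] at htr
      have hent : ∀ a b, |((B * G)ᵀ * (B * G)) a b| ≤ r + 1 / 10000 := fun a b => by
        set c : Fin r → ℝ := fun k =>
          ‖toEuclideanLin (B * G) (EuclideanSpace.single k 1)‖ with hc
        have h1 : ((B * G)ᵀ * (B * G)) a b = inner ℝ
            (toEuclideanLin (B * G) (EuclideanSpace.single a 1))
            (toEuclideanLin (B * G) (EuclideanSpace.single b 1)) := by
          generalize B * G = M
          rw [Matrix.mul_apply]
          simp [toLpLin_apply, PiLp.inner_apply, mul_comm]
        have h2 : ∀ k, c k ^ 2 ≤ r + 1 / 10000 := fun k =>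
          (Finset.single_le_sum (f := fun k => c k ^ 2) (fun j _ => sq_nonneg _)
            (Finset.mem_univ k)).trans htr
        rw [h1]
        refine (abs_real_inner_le_norm _ _).trans ?_
        change c a * c b ≤ _
        nlinarith [h2 a, h2 b, sq_nonneg (c a - c b)]
      rw [hD]
      exact fun a _ b _ => abs_le.mp (hent a b)
    · change (G⁻¹)ᵀ * ((B * G)ᵀ * (B * G)) * G⁻¹ = L
      have h1 : G * G⁻¹ = 1 := Matrix.mul_nonsing_inv _ hG
      calc (G⁻¹)ᵀ * ((B * G)ᵀ * (B * G)) * G⁻¹ = (G * G⁻¹)ᵀ * (Bᵀ * B) * (G * G⁻¹) := by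
            simp only [Matrix.transpose_mul, Matrix.mul_assoc]
        _ = L := by rw [h1, hB]; simp
  have hfeas := feasible_smul_inv hG hP hs hqs
  obtain ⟨L, hLK, hLmax⟩ := hcompact.exists_isMaxOn ⟨_, hfeas.1.posSemidef, hfeas.2⟩
    (f := Matrix.det) (by fun_prop)
  have hdet : 0 < L.det := hfeas.1.det_pos.trans_le (hLmax ⟨hfeas.1.posSemidef, hfeas.2⟩)
  refine ⟨L, ⟨hLK.1.posDef_iff_det_ne_zero.mpr hdet.ne', hLK.2⟩, fun L' hL' => ?_⟩
  exact neg_le_neg (Real.log_le_log hL'.1.det_pos (hLmax ⟨hL'.1.posSemidef, hL'.2⟩))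

/-- Any optimal solution of the ellipsoid problem makes the vertices well-conditioned. -/
lemma bounds_of_ellipsoidOptimal {r m : ℕ} (hr : 1 ≤ r) {P : Matrix (Fin r) (Fin m) ℝ}
    {G : Matrix (Fin r) (Fin r) ℝ} (hG : IsUnit G.det) {q : Fin m → EuclideanSpace ℝ (Fin r)}
    (hP : ∀ i, col P i = toEuclideanLin G (q i))
    (ι : Fin r → Fin m) {δ : ℝ} (hδ0 : 0 ≤ δ) (hδ : δ * (r * √r) ≤ 1 / 40000)
    (hq : ∀ k, ‖q (ι k) - EuclideanSpace.single k 1‖ ≤ δ) (hq1 : ∀ i, ‖q i‖ ≤ 1 + δ)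
    {L B : Matrix (Fin r) (Fin r) ℝ} (hL : EllipsoidOptimal P L) (hB : Bᵀ * B = L)
    (x : EuclideanSpace ℝ (Fin r)) :
    ‖x‖ / 2 ≤ ‖toEuclideanLin (B * G) x‖ ∧ ‖toEuclideanLin (B * G) x‖ ≤ 2 * ‖x‖ := by
  have hs : 0 < 1 + δ := by linarith
  have hr1 : 1 ≤ √(r : ℝ) := by
    rw [Real.one_le_sqrt]
    exact_mod_cast hr
  have hdr : δ * r ≤ 1 / 40000 := by
    have : δ * r ≤ δ * (r * √r) := by
      rw [← mul_assoc]
      exact le_mul_of_one_le_right (by positivity) hr1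
    linarith
  have hGd : 0 < G.det ^ 2 := by
    have := hG.ne_zero
    positivity
  have hLd := hL.1.1.det_pos
  have hQdet : ((B * G)ᵀ * (B * G)).det = G.det ^ 2 * L.det := by
    rw [← hB]
    simp only [Matrix.det_mul, Matrix.det_transpose]
    ring
  have hQ : ((B * G)ᵀ * (B * G)).PosDef := by
    have h1 : ((B * G)ᵀ * (B * G)).PosSemidef := by
      simpa using Matrix.posSemidef_conjTranspose_mul_self (B * G)
    rw [h1.posDef_iff_det_ne_zero, hQdet]
    positivity
  have htr := trace_le_of_feasible hP ι hδ0 hδ hq (B := B) (by rw [hB]; exact hL.1.2)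
  have hopt := hL.2 _ (feasible_smul_inv hG hP hs hq1)
  have hdet0 : ((((1 + δ)⁻¹ • G⁻¹)ᵀ * ((1 + δ)⁻¹ • G⁻¹)).det)
      = ((1 + δ) ^ (2 * r))⁻¹ * (G.det ^ 2)⁻¹ := by
    rw [Matrix.det_mul, Matrix.det_transpose, Matrix.det_smul, Matrix.det_nonsing_inv,
      Ring.inverse_eq_inv', Fintype.card_fin, inv_pow, mul_comm 2 r, pow_mul]
    have := hG.ne_zero
    field_simp
  rw [hdet0, Real.log_mul (by positivity) (by positivity), Real.log_inv, Real.log_inv,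
    Real.log_pow] at hopt
  have hlog : Real.log (1 + δ) ≤ δ := by
    have := Real.log_le_sub_one_of_pos hs
    linarith
  -- Optimality gives the lower bound `-2 * r * log (1 + δ) ≥ -2 * r * δ`. The value `1/10` is
  -- generous: with the trace excess it only has to stay below `19/100`.
  have hlogQ : -(1 / 10) ≤ Real.log ((B * G)ᵀ * (B * G)).det := by
    rw [hQdet, Real.log_mul hGd.ne' hLd.ne']
    have h1 : (r : ℝ) * Real.log (1 + δ) ≤ r * δ := mul_le_mul_of_nonneg_left hlog (by positivity)
    push_cast at hopt
    linarith
  obtain ⟨h1, h2⟩ := quadratic_bounds_of_trace_sub_log_det_le hQ (by linarith) x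
  have h3 : inner ℝ x (toEuclideanLin ((B * G)ᵀ * (B * G)) x) = ‖toEuclideanLin (B * G) x‖ ^ 2 := by
    have := norm_sq_toEuclideanLin (B * G) x.ofLp
    rw [WithLp.toLp_ofLp] at this
    rw [this]
    generalize (B * G)ᵀ * (B * G) = M
    simp [toLpLin_apply, PiLp.inner_apply, dotProduct, mul_comm]
  rw [h3] at h1 h2
  constructor
  · apply le_of_sq_le_sq _ (norm_nonneg _)
    nlinarith [norm_nonneg x]
  · apply le_of_sq_le_sq _ (by positivity)
    nlinarith [norm_nonneg x]

/-! ### Singular values and norm bounds -/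

lemma norm_sq_toEuclideanLin_eq_sum {d m r : ℕ} (F : Matrix (Fin d) (Fin m) ℝ)
    (hr : Module.finrank ℝ (EuclideanSpace ℝ (Fin m)) = r) (x : EuclideanSpace ℝ (Fin m)) :
    ‖toEuclideanLin F x‖ ^ 2 = ∑ i : Fin r, (toEuclideanLin F).singularValues i ^ 2 *
      inner ℝ ((toEuclideanLin F).isSymmetric_adjoint_comp_self.eigenvectorBasis hr i) x ^ 2 := by
  set T := toEuclideanLin F
  rw [← real_inner_self_eq_norm_sq, ← LinearMap.adjoint_inner_right, ← LinearMap.comp_apply]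
  refine inner_map_self_eq_sum _ _ (fun i : Fin r => T.singularValues i ^ 2) (fun i => ?_) x
  rw [T.sq_singularValues_fin hr]
  exact T.isSymmetric_adjoint_comp_self.apply_eigenvectorBasis hr i

lemma norm_toEuclideanLin_le_sigmaMax {d m : ℕ} (F : Matrix (Fin d) (Fin m) ℝ)
    (x : EuclideanSpace ℝ (Fin m)) : ‖toEuclideanLin F x‖ ≤ sigmaMax F * ‖x‖ := by
  have hm : Module.finrank ℝ (EuclideanSpace ℝ (Fin m)) = m := finrank_euclideanSpace_fin
  have h0 := (toEuclideanLin F).singularValues_nonneg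
  apply le_of_sq_le_sq _ (mul_nonneg (h0 _) (norm_nonneg _))
  rw [mul_pow, norm_sq_toEuclideanLin_eq_sum F hm, norm_sq_eq_sum
    ((toEuclideanLin F).isSymmetric_adjoint_comp_self.eigenvectorBasis hm) x, Finset.mul_sum]
  refine Finset.sum_le_sum fun i _ => mul_le_mul_of_nonneg_right ?_ (sq_nonneg _)
  exact pow_le_pow_left₀ (h0 _) ((toEuclideanLin F).singularValues_antitone (Nat.zero_le _)) 2

/-- For `r ≤ d` the index `min d r - 1` is `r - 1`, the last one in the eigenbasis expansion of `‖F
x‖ ^ 2`. For `r > d` a kernel vector can violate the bound. -/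
lemma sigmaMin_le_norm {d r : ℕ} (hrd : r ≤ d) (F : Matrix (Fin d) (Fin r) ℝ)
    (x : EuclideanSpace ℝ (Fin r)) : sigmaMin F * ‖x‖ ≤ ‖toEuclideanLin F x‖ := by
  have hr : Module.finrank ℝ (EuclideanSpace ℝ (Fin r)) = r := finrank_euclideanSpace_fin
  have h0 := (toEuclideanLin F).singularValues_nonneg
  apply le_of_sq_le_sq _ (norm_nonneg _)
  rw [mul_pow, norm_sq_toEuclideanLin_eq_sum F hr, norm_sq_eq_sum
    ((toEuclideanLin F).isSymmetric_adjoint_comp_self.eigenvectorBasis hr) x, Finset.mul_sum]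
  refine Finset.sum_le_sum fun i _ => mul_le_mul_of_nonneg_right ?_ (sq_nonneg _)
  refine pow_le_pow_left₀ (h0 _) ((toEuclideanLin F).singularValues_antitone ?_) 2
  have := i.isLt
  omega

lemma le_of_rank_eq {d r : ℕ} {F : Matrix (Fin d) (Fin r) ℝ} (hF : F.rank = r) : r ≤ d := by
  have := F.rank_le_card_height
  rw [hF, Fintype.card_fin] at this
  exact this

lemma sigmaMin_pos {d r : ℕ} (hr : 1 ≤ r) {F : Matrix (Fin d) (Fin r) ℝ} (hF : F.rank = r) :
    0 < sigmaMin F := by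
  have hd := le_of_rank_eq hF
  rw [sigmaMin, LinearMap.singularValues_pos_iff_lt_finrank_range, min_eq_right hd]
  have h1 : Module.finrank ℝ (LinearMap.range (toEuclideanLin F)) = F.rank :=
    (F.rank_eq_finrank_range_toLin (PiLp.basisFun 2 ℝ (Fin d)) (PiLp.basisFun 2 ℝ (Fin r))).symm
  rw [h1, hF]
  omega

lemma sigmaMin_le_sigmaMax {d m : ℕ} (F : Matrix (Fin d) (Fin m) ℝ) : sigmaMin F ≤ sigmaMax F :=
  (toEuclideanLin F).singularValues_antitone (Nat.zero_le _)

lemma norm_toEuclideanLin_le_specNorm {d m : ℕ} (N : Matrix (Fin d) (Fin m) ℝ)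
    (x : EuclideanSpace ℝ (Fin m)) : ‖toEuclideanLin N x‖ ≤ specNorm N * ‖x‖ :=
  Matrix.l2_opNorm_mulVec N x

open scoped Matrix.Norms.L2Operator in
lemma specNorm_nonneg {d m : ℕ} (N : Matrix (Fin d) (Fin m) ℝ) : 0 ≤ specNorm N :=
  norm_nonneg N

/-! ### Orthogonal matrices and singular value decompositions -/

lemma norm_toEuclideanLin_of_transpose_mul_self {n r : ℕ} {U : Matrix (Fin n) (Fin r) ℝ}
    (hU : Uᵀ * U = 1) (x : EuclideanSpace ℝ (Fin r)) : ‖toEuclideanLin U x‖ = ‖x‖ := by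
  have h1 := norm_sq_toEuclideanLin U x.ofLp
  have h2 := norm_sq_toEuclideanLin (1 : Matrix (Fin r) (Fin r) ℝ) x.ofLp
  rw [WithLp.toLp_ofLp] at h1 h2
  have h3 : ‖toEuclideanLin U x‖ ^ 2 = ‖x‖ ^ 2 := by
    rw [h1, hU]
    simpa using h2.symm
  exact (pow_left_inj₀ (norm_nonneg _) (norm_nonneg _) two_ne_zero).mp h3

lemma transpose_mul_self_of_mem {n : ℕ} {U : Matrix (Fin n) (Fin n) ℝ}
    (hU : U ∈ Matrix.orthogonalGroup (Fin n) ℝ) : Uᵀ * U = 1 ∧ U * Uᵀ = 1 :=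
  ⟨(Matrix.mem_orthogonalGroup_iff' (Fin n) ℝ).mp hU,
    (Matrix.mem_orthogonalGroup_iff (Fin n) ℝ).mp hU⟩

/-- The `d × m` diagonal matrix with the given diagonal entries. -/
def rectDiagonal {d m : ℕ} (σ : Fin (min d m) → ℝ) : Matrix (Fin d) (Fin m) ℝ :=
  Matrix.of fun (i : Fin d) (j : Fin m) =>
    if h : i.val = j.val then σ ⟨i.val, lt_min i.isLt (h ▸ j.isLt)⟩ else 0

lemma rectDiagonal_mulVec {d m : ℕ} (σ : Fin (min d m) → ℝ) (y : Fin m → ℝ) (i : Fin d) :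
    (rectDiagonal σ *ᵥ y) i =
      if h : i.val < m then σ ⟨i, lt_min i.isLt h⟩ * y ⟨i, h⟩ else 0 := by
  rw [mulVec, dotProduct]
  split_ifs with h
  · rw [Finset.sum_eq_single ⟨i, h⟩]
    · simp [rectDiagonal]
    · intro j _ hj
      have : i.val ≠ j.val := fun h' => hj (Fin.ext h'.symm)
      simp [rectDiagonal, this]
    · simp
  · refine Finset.sum_eq_zero fun j _ => ?_
    have : i.val ≠ j.val := by
      have := j.isLt
      omega
    simp [rectDiagonal, this]

lemma norm_sq_rectDiagonal {d m : ℕ} (σ : Fin (min d m) → ℝ) (y : EuclideanSpace ℝ (Fin m)) :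
    ‖toEuclideanLin (rectDiagonal σ) y‖ ^ 2 =
      ∑ k, (σ k * y (Fin.castLE (min_le_right d m) k)) ^ 2 := by
  rw [EuclideanSpace.norm_sq_eq]
  symm
  refine Fintype.sum_of_injective (Fin.castLE (min_le_left d m)) (Fin.castLE_injective _) _ _ ?_ ?_
  · intro i hi
    have : ¬ i.val < m := fun h => hi ⟨⟨i, lt_min i.isLt h⟩, rfl⟩
    simp [toLpLin_apply, rectDiagonal_mulVec, this]
  · intro k
    have : k.val < m := lt_of_lt_of_le k.isLt (min_le_right d m)
    simp only [toLpLin_apply, rectDiagonal_mulVec, Fin.val_castLE, this, dite_true,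
      Real.norm_eq_abs, sq_abs]
    rfl

lemma sum_castLE_sq_le {k m : ℕ} (h : k ≤ m) (y : EuclideanSpace ℝ (Fin m)) :
    ∑ j, y (Fin.castLE h j) ^ 2 ≤ ‖y‖ ^ 2 := by
  rw [EuclideanSpace.norm_sq_eq]
  have h1 := Finset.sum_map Finset.univ (Fin.castLEEmb h) (fun j => y j ^ 2)
  simp only [Fin.castLEEmb_apply, Real.norm_eq_abs, sq_abs] at h1 ⊢
  rw [← h1]
  exact Finset.sum_le_univ_sum_of_nonneg fun j => sq_nonneg _

/-- Every real matrix has a singular value decomposition. -/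
lemma exists_isSVD {d m : ℕ} (A : Matrix (Fin d) (Fin m) ℝ) : ∃ U σ V, IsSVD A U σ V := by
  set T := toEuclideanLin A with hT
  have hm : Module.finrank ℝ (EuclideanSpace ℝ (Fin m)) = m := finrank_euclideanSpace_fin
  set b := T.isSymmetric_adjoint_comp_self.eigenvectorBasis hm with hb
  set s : ℕ → ℝ := fun k => T.singularValues k with hs
  have hs0 : ∀ k, 0 ≤ s k := T.singularValues_nonneg
  have hTb : ∀ i j, inner ℝ (T (b i)) (T (b j)) = if i = j then s j ^ 2 else 0 := by
    intro i j
    rw [← LinearMap.adjoint_inner_right, ← LinearMap.comp_apply, hb,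
      T.isSymmetric_adjoint_comp_self.apply_eigenvectorBasis hm j, ← hb, inner_smul_right,
      orthonormal_iff_ite.mp b.orthonormal, hs]
    simp only [T.sq_singularValues_fin hm]
    simp
  have hrange : ∀ j : Fin m, s j ≠ 0 → j.val < d := by
    intro j hj
    have h1 : 0 < T.singularValues j := lt_of_le_of_ne (hs0 j) (Ne.symm hj)
    rw [LinearMap.singularValues_pos_iff_lt_finrank_range] at h1
    have h2 := Submodule.finrank_le (LinearMap.range T)
    rw [finrank_euclideanSpace_fin] at h2
    omega
  -- Left singular vectors are forced where the singular value is nonzero. Elsewhere the values of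
  -- `u` are irrelevant, as only its restriction to `X` is extended to an orthonormal basis.
  set u : Fin d → EuclideanSpace ℝ (Fin d) := fun i =>
    if h : i.val < m then (s i)⁻¹ • T (b ⟨i, h⟩) else 0 with hu
  set X : Set (Fin d) := {i | i.val < m ∧ s i ≠ 0}
  have horth : Orthonormal ℝ (X.domRestrict u) := by
    rw [orthonormal_iff_ite]
    rintro ⟨i, him, hi⟩ ⟨j, hjm, hj⟩
    simp only [Set.domRestrict_apply, hu, him, hjm, dite_true, inner_smul_left, inner_smul_right,
      hTb, Subtype.mk.injEq, Fin.ext_iff]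
    split_ifs with hij
    · simp only [hij] at hi ⊢
      simp
      field_simp
    · simp
  obtain ⟨c, hc⟩ := horth.exists_orthonormalBasis_extension_of_card_eq (by simp)
  have hTc : ∀ j : Fin m, ∀ h : j.val < d, T (b j) = s j • c ⟨j, h⟩ := by
    intro j h
    by_cases hj : s j = 0
    · have h1 := hTb j j
      rw [real_inner_self_eq_norm_sq, hj] at h1
      have h2 : T (b j) = 0 := by simpa using h1
      rw [h2, hj, zero_smul]
    · rw [hc ⟨j, h⟩ ⟨j.isLt, hj⟩]
      simp only [hu, j.isLt, dite_true]
      rw [smul_smul, mul_inv_cancel₀ hj, one_smul]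
  have hTz : ∀ j : Fin m, ¬ j.val < d → T (b j) = 0 := by
    intro j h
    have h1 := hTb j j
    have h3 : s j = 0 := by
      by_contra h'
      exact h (hrange j h')
    rw [real_inner_self_eq_norm_sq, h3] at h1
    simpa using h1
  have horthog : ∀ (n : ℕ) (c : OrthonormalBasis (Fin n) ℝ (EuclideanSpace ℝ (Fin n))),
      (Matrix.of fun a i => c i a) ∈ Matrix.orthogonalGroup (Fin n) ℝ := by
    intro n c
    rw [Matrix.mem_orthogonalGroup_iff']
    ext i j
    have := orthonormal_iff_ite.mp c.orthonormal i j
    simp only [PiLp.inner_apply] at this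
    rw [Matrix.mul_apply, Matrix.one_apply, ← this]
    refine Finset.sum_congr rfl fun a _ => ?_
    simp [mul_comm]
  refine ⟨Matrix.of fun a i => c i a, fun k => s k, Matrix.of fun a j => b j a, horthog d c,
    horthog m b, fun k => hs0 k, fun i j hij => T.singularValues_antitone hij, ?_⟩
  have hV := (transpose_mul_self_of_mem (horthog m b)).2
  set V : Matrix (Fin m) (Fin m) ℝ := Matrix.of fun a j => b j a with hVdef
  set U : Matrix (Fin d) (Fin d) ℝ := Matrix.of fun a i => c i a with hUdef
  change A = U * rectDiagonal (d := d) (m := m) (fun k => s k) * Vᵀ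
  have hAV : A * V = U * rectDiagonal (d := d) (m := m) (fun k => s k) := by
    ext a j
    have h1 : (A * V) a j = T (b j) a := by
      simp [hT, toLpLin_apply, Matrix.mul_apply, mulVec, dotProduct, hVdef]
    rw [h1, Matrix.mul_apply]
    by_cases h : j.val < d
    · rw [hTc j h, Finset.sum_eq_single ⟨j, h⟩]
      · simp [rectDiagonal, mul_comm, hUdef]
      · intro i _ hi
        have : i.val ≠ j.val := fun h' => hi (Fin.ext h')
        simp [rectDiagonal, this]
      · simp
    · rw [hTz j h, Finset.sum_eq_zero]
      · simp
      · intro i _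
        have : i.val ≠ j.val := by
          have := i.isLt
          omega
        simp [rectDiagonal, this]
  rw [← hAV, Matrix.mul_assoc, hV, Matrix.mul_one]

/-! ### The leading singular subspace -/

/-- The matrix of the first `r` columns. -/
def firstCols {d n r : ℕ} (h : r ≤ n) (U : Matrix (Fin d) (Fin n) ℝ) : Matrix (Fin d) (Fin r) ℝ :=
  U.submatrix id (Fin.castLE h)

lemma IsSVD.transpose_mul {d m : ℕ} {A : Matrix (Fin d) (Fin m) ℝ} {U : Matrix (Fin d) (Fin d) ℝ}
    {σ : Fin (min d m) → ℝ} {V : Matrix (Fin m) (Fin m) ℝ} (h : IsSVD A U σ V) :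
    Uᵀ * A = rectDiagonal σ * Vᵀ := by
  have h1 : A = U * rectDiagonal σ * Vᵀ := h.eq_mul
  rw [h1, Matrix.mul_assoc, ← Matrix.mul_assoc Uᵀ, (transpose_mul_self_of_mem h.1).1,
    Matrix.one_mul]

/-- These are the first `r` rows of `Uᵀ A = Σ Vᵀ`. In this form `P` is linear in the data, so it
splits into a vertex part and a noise part. -/
lemma IsSVD.reduced_eq {d m r : ℕ} {A : Matrix (Fin d) (Fin m) ℝ} {U : Matrix (Fin d) (Fin d) ℝ}
    {σ : Fin (min d m) → ℝ} {V : Matrix (Fin m) (Fin m) ℝ} (h : IsSVD A U σ V)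
    (hr : r ≤ min d m) :
    reduced hr σ V = (firstCols (hr.trans (min_le_left d m)) U)ᵀ * A := by
  ext k j
  have h1 : ((firstCols (hr.trans (min_le_left d m)) U)ᵀ * A) k j
      = (Uᵀ * A) (Fin.castLE (hr.trans (min_le_left d m)) k) j := rfl
  have h2 : (rectDiagonal σ * Vᵀ) (Fin.castLE (hr.trans (min_le_left d m)) k) j
      = (rectDiagonal σ *ᵥ (V j)) (Fin.castLE (hr.trans (min_le_left d m)) k) := rfl
  have h3 : k.val < m := lt_of_lt_of_le k.isLt (hr.trans (min_le_right d m))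
  rw [h1, h.transpose_mul, h2, rectDiagonal_mulVec]
  simp only [Fin.val_castLE, h3, dite_true, reduced, Matrix.diagonal_mul]
  rfl

/-- The last `d - r` coordinates of a vector in the orthonormal system of the columns of `U`. -/
def tailCoords {d : ℕ} (r : ℕ) (U : Matrix (Fin d) (Fin d) ℝ) : Matrix (Fin d) (Fin d) ℝ :=
  Matrix.diagonal (fun i : Fin d => if i.val < r then (0 : ℝ) else 1) * Uᵀ

lemma norm_sq_eq_firstCols_add_tailCoords {d r : ℕ} (h : r ≤ d) {U : Matrix (Fin d) (Fin d) ℝ}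
    (hU : U ∈ Matrix.orthogonalGroup (Fin d) ℝ) (x : EuclideanSpace ℝ (Fin d)) :
    ‖x‖ ^ 2 = ‖toEuclideanLin (firstCols h U)ᵀ x‖ ^ 2 + ‖toEuclideanLin (tailCoords r U) x‖ ^ 2 := by
  have h1 : ‖toEuclideanLin Uᵀ x‖ = ‖x‖ := norm_toEuclideanLin_of_transpose_mul_self
    (by rw [Matrix.transpose_transpose]; exact (transpose_mul_self_of_mem hU).2) x
  rw [← h1]
  have h2 : ‖toEuclideanLin (firstCols h U)ᵀ x‖ ^ 2
      = ∑ i : Fin d, if i.val < r then (toEuclideanLin Uᵀ x) i ^ 2 else 0 := by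
    rw [EuclideanSpace.norm_sq_eq]
    refine Fintype.sum_of_injective (Fin.castLE h) (Fin.castLE_injective _) _ _ ?_ ?_
    · intro i hi
      have : ¬ i.val < r := fun h' => hi ⟨⟨i, h'⟩, rfl⟩
      simp [this]
    · intro k
      simp [toLpLin_apply, mulVec, dotProduct, firstCols]
  rw [h2, tailCoords, toEuclideanLin_mul_apply, EuclideanSpace.norm_sq_eq, EuclideanSpace.norm_sq_eq,
    ← Finset.sum_add_distrib]
  refine Finset.sum_congr rfl fun i _ => ?_
  rw [toLpLin_apply (p := 2) (q := 2) (diagonal _)]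
  simp only [mulVec_diagonal]
  by_cases hi : i.val < r <;> simp [hi]

/-- The singular values after the `r`-th are bounded by the distance to a matrix that factors
through dimension `r`. -/
lemma IsSVD.singular_le {d m r : ℕ} {F : Matrix (Fin d) (Fin r) ℝ} {W : Matrix (Fin r) (Fin m) ℝ}
    {N : Matrix (Fin d) (Fin m) ℝ} {U : Matrix (Fin d) (Fin d) ℝ}
    {σ : Fin (min d m) → ℝ} {V : Matrix (Fin m) (Fin m) ℝ} (h : IsSVD (F * W + N) U σ V)
    (k : Fin (min d m)) (hk : r ≤ k.val) : σ k ≤ specNorm N := by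
  have hkm : k.val < m := lt_of_lt_of_le k.isLt (min_le_right d m)
  obtain ⟨hV1, hV2⟩ := transpose_mul_self_of_mem h.2
  -- Min-max by dimension count: `r + (m - 1 - k) < m` conditions leave a nonzero `y` supported on
  -- indices up to `k` with `W V y = 0`. There the data acts as `N`, while `Σ` stretches `y` by at
  -- least `σ k`.
  let Φ : (Fin m → ℝ) →ₗ[ℝ] (Fin r → ℝ) × ({j : Fin m // k.val < j.val} → ℝ) :=
    (Matrix.mulVecLin (W * V)).prod (LinearMap.funLeft ℝ ℝ Subtype.val)
  have hΦ : LinearMap.ker Φ ≠ ⊥ := by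
    apply LinearMap.ker_ne_bot_of_finrank_lt
    have h1 : Fintype.card {j : Fin m // k.val < j.val} = m - 1 - k.val := by
      have := Fin.card_Ioi (⟨k.val, hkm⟩ : Fin m)
      rw [Fintype.card_subtype, ← this]
      congr 1
      ext j
      simp [Fin.lt_def]
    rw [Module.finrank_prod, Module.finrank_fintype_fun_eq_card, Module.finrank_fintype_fun_eq_card,
      Module.finrank_fintype_fun_eq_card, h1, Fintype.card_fin, Fintype.card_fin]
    omega
  obtain ⟨y, hy, hy0⟩ := Submodule.exists_mem_ne_zero_of_ne_bot hΦ
  have hy' : Φ y = 0 := hy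
  have hyW : (W * V) *ᵥ y = 0 := congrArg Prod.fst hy'
  have hyt : ∀ j : Fin m, k.val < j.val → y j = 0 := fun j hj =>
    congrFun (congrArg Prod.snd hy') ⟨j, hj⟩
  set Y : EuclideanSpace ℝ (Fin m) := WithLp.toLp 2 y with hY
  have hYpos : 0 < ‖Y‖ := by
    rw [norm_pos_iff]
    intro h'
    exact hy0 (by simpa [hY] using congrArg WithLp.ofLp h')
  have hVn : ‖toEuclideanLin V Y‖ = ‖Y‖ := norm_toEuclideanLin_of_transpose_mul_self hV1 Y
  have hup : ‖toEuclideanLin (rectDiagonal σ) Y‖ ≤ specNorm N * ‖Y‖ := by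
    have h1 : toEuclideanLin (F * W + N) (toEuclideanLin V Y)
        = toEuclideanLin N (toEuclideanLin V Y) := by
      have h2 : toEuclideanLin W (toEuclideanLin V Y) = 0 := by
        rw [← toEuclideanLin_mul_apply, hY, toLpLin_apply]
        simp [hyW]
      rw [map_add, LinearMap.add_apply, toEuclideanLin_mul_apply, h2, map_zero, zero_add]
    have h3 : toEuclideanLin Uᵀ (toEuclideanLin (F * W + N) (toEuclideanLin V Y))
        = toEuclideanLin (rectDiagonal σ) Y := by
      rw [← toEuclideanLin_mul_apply, ← toEuclideanLin_mul_apply, h.transpose_mul,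
        Matrix.mul_assoc, hV1, Matrix.mul_one]
    rw [← h3, norm_toEuclideanLin_of_transpose_mul_self
      (by rw [Matrix.transpose_transpose]; exact (transpose_mul_self_of_mem h.1).2), h1, ← hVn]
    exact norm_toEuclideanLin_le_specNorm N _
  have hlow : (σ k * ‖Y‖) ^ 2 ≤ ‖toEuclideanLin (rectDiagonal σ) Y‖ ^ 2 := by
    have h1 : ‖Y‖ ^ 2 = ∑ l, Y (Fin.castLE (min_le_right d m) l) ^ 2 := by
      rw [EuclideanSpace.norm_sq_eq]
      symm
      refine Fintype.sum_of_injective (Fin.castLE (min_le_right d m)) (Fin.castLE_injective _) _ _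
        ?_ ?_
      · intro j hj
        have : k.val < j.val := by
          by_contra h'
          exact hj ⟨⟨j, by omega⟩, rfl⟩
        simp [hY, hyt j this]
      · intro l
        simp
    rw [mul_pow, h1, norm_sq_rectDiagonal, Finset.mul_sum]
    refine Finset.sum_le_sum fun l _ => ?_
    rw [mul_pow]
    by_cases hl : k.val < l.val
    · have : Y (Fin.castLE (min_le_right d m) l) = 0 := hyt _ hl
      simp [this]
    · exact mul_le_mul_of_nonneg_right
        (pow_le_pow_left₀ (h.nonneg k) (h.antitone (Fin.le_def.mpr (by omega))) 2) (sq_nonneg _)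
  have h1 := le_of_sq_le_sq hlow (norm_nonneg _)
  exact le_of_mul_le_mul_right (h1.trans hup) hYpos

/-- Dropping the first `r` rows of `Σ Vᵀ` leaves only singular values bounded by
`IsSVD.singular_le`. -/
lemma IsSVD.norm_tailCoords_le {d m r : ℕ} {F : Matrix (Fin d) (Fin r) ℝ}
    {W : Matrix (Fin r) (Fin m) ℝ} {N : Matrix (Fin d) (Fin m) ℝ} {U : Matrix (Fin d) (Fin d) ℝ}
    {σ : Fin (min d m) → ℝ} {V : Matrix (Fin m) (Fin m) ℝ} (h : IsSVD (F * W + N) U σ V)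
    (x : EuclideanSpace ℝ (Fin m)) :
    ‖toEuclideanLin (tailCoords r U) (toEuclideanLin (F * W + N) x)‖ ≤ specNorm N * ‖x‖ := by
  have hd : Matrix.diagonal (fun i : Fin d => if i.val < r then (0 : ℝ) else 1) * rectDiagonal σ
      = rectDiagonal (fun k => if k.val < r then 0 else σ k) := by
    ext i j
    rw [Matrix.diagonal_mul]
    simp only [rectDiagonal, Matrix.of_apply]
    split_ifs <;> simp
  have hV := (transpose_mul_self_of_mem h.2).2
  rw [← toEuclideanLin_mul_apply, tailCoords, Matrix.mul_assoc, h.transpose_mul, ← Matrix.mul_assoc,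
    hd, toEuclideanLin_mul_apply]
  have hx : ‖toEuclideanLin Vᵀ x‖ = ‖x‖ := norm_toEuclideanLin_of_transpose_mul_self
    (by rw [Matrix.transpose_transpose]; exact hV) x
  rw [← hx]
  set y := toEuclideanLin Vᵀ x
  have hN := specNorm_nonneg N
  apply le_of_sq_le_sq _ (by positivity)
  rw [norm_sq_rectDiagonal, mul_pow]
  refine le_trans ?_ (mul_le_mul_of_nonneg_left (sum_castLE_sq_le (min_le_right d m) y)
    (sq_nonneg _))
  rw [Finset.mul_sum]
  refine Finset.sum_le_sum fun k _ => ?_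
  rw [mul_pow]
  refine mul_le_mul_of_nonneg_right ?_ (sq_nonneg _)
  split_ifs with hk
  · rw [zero_pow two_ne_zero]
    positivity
  · exact pow_le_pow_left₀ (h.nonneg k) (h.singular_le k (not_lt.mp hk)) 2

/-! ### Assembly -/

lemma SPALoop.mono {d m r : ℕ} {Q Q' : Finset (Fin m) → Prop} (hQ : ∀ I, Q I → Q' I)
    {S : Matrix (Fin d) (Fin m) ℝ} {I : Finset (Fin m)} (h : SPALoop r Q S I) :
    SPALoop r Q' S I := by
  induction h with
  | halt hI hQI => exact .halt hI (hQ _ hQI)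
  | step hI hex hne _ ih => exact .step hI hex hne ih

lemma col_eq_toEuclideanLin {d m : ℕ} (M : Matrix (Fin d) (Fin m) ℝ) (i : Fin m) :
    col M i = toEuclideanLin M (EuclideanSpace.single i 1) := by
  ext a
  simp [col, toLpLin_apply]

lemma norm_col_le_specNorm {d m : ℕ} (N : Matrix (Fin d) (Fin m) ℝ) (i : Fin m) :
    ‖col N i‖ ≤ specNorm N := by
  rw [col_eq_toEuclideanLin]
  simpa [PiLp.norm_single] using norm_toEuclideanLin_le_specNorm N (EuclideanSpace.single i 1)

/-- The columns of the nonnegative factor of a separable matrix, and the positions at which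
it has the unit vectors. -/
lemma SeparableWith.exists_factor {d m r : ℕ} {A : Matrix (Fin d) (Fin m) ℝ}
    {F : Matrix (Fin d) (Fin r) ℝ} (h : SeparableWith A F) :
    ∃ (W : Matrix (Fin r) (Fin m) ℝ) (ι : Fin r → Fin m), A = F * W ∧ Function.Injective ι ∧
      (∀ k i, 0 ≤ W k i) ∧ (∀ i, ∑ k, W k i ≤ 1) ∧ ∀ j k, W k (ι j) = if k = j then 1 else 0 := by
  obtain ⟨-, K, e, hK0, hK1, hA⟩ := h
  refine ⟨_, fun j => e.symm (Sum.inl j), hA, fun a b hab => ?_, fun k i => ?_, fun i => ?_,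
    fun j k => ?_⟩
  · exact Sum.inl_injective (e.symm.injective hab)
  · rw [submatrix_apply]
    rcases e i with j | j
    · simp only [fromCols_apply_inl, id, one_apply]
      split_ifs <;> norm_num
    · exact hK0 k j
  · simp only [submatrix_apply, id]
    rcases e i with j | j
    · simp [one_apply]
    · exact hK1 j
  · simp [one_apply]

lemma norm_firstCols_transpose_le {d r : ℕ} (h : r ≤ d) {U : Matrix (Fin d) (Fin d) ℝ}
    (hU : U ∈ Matrix.orthogonalGroup (Fin d) ℝ) (x : EuclideanSpace ℝ (Fin d)) :
    ‖toEuclideanLin (firstCols h U)ᵀ x‖ ≤ ‖x‖ := by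
  apply le_of_sq_le_sq _ (norm_nonneg _)
  rw [norm_sq_eq_firstCols_add_tailCoords h hU x]
  exact le_add_of_nonneg_right (sq_nonneg _)

lemma norm_tailCoords_le_norm {d r : ℕ} (h : r ≤ d) {U : Matrix (Fin d) (Fin d) ℝ}
    (hU : U ∈ Matrix.orthogonalGroup (Fin d) ℝ) (x : EuclideanSpace ℝ (Fin d)) :
    ‖toEuclideanLin (tailCoords r U) x‖ ≤ ‖x‖ := by
  apply le_of_sq_le_sq _ (norm_nonneg _)
  rw [norm_sq_eq_firstCols_add_tailCoords h hU x]
  exact le_add_of_nonneg_left (sq_nonneg _)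

lemma norm_le_firstCols_add_tailCoords {d r : ℕ} (h : r ≤ d) {U : Matrix (Fin d) (Fin d) ℝ}
    (hU : U ∈ Matrix.orthogonalGroup (Fin d) ℝ) (x : EuclideanSpace ℝ (Fin d)) :
    ‖x‖ ≤ ‖toEuclideanLin (firstCols h U)ᵀ x‖ + ‖toEuclideanLin (tailCoords r U) x‖ := by
  apply le_of_sq_le_sq _ (by positivity)
  rw [norm_sq_eq_firstCols_add_tailCoords h hU x, add_sq]
  have : 0 ≤ ‖toEuclideanLin (firstCols h U)ᵀ x‖ * ‖toEuclideanLin (tailCoords r U) x‖ := by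
    positivity
  linarith

/-- The vertices lie almost in the span of the leading left singular vectors of the data. -/
lemma IsSVD.norm_tailCoords_factor_le {d m r : ℕ} (hrd : r ≤ d) {F : Matrix (Fin d) (Fin r) ℝ}
    {W : Matrix (Fin r) (Fin m) ℝ} {N : Matrix (Fin d) (Fin m) ℝ} {U : Matrix (Fin d) (Fin d) ℝ}
    {σ : Fin (min d m) → ℝ} {V : Matrix (Fin m) (Fin m) ℝ} (h : IsSVD (F * W + N) U σ V)
    {ι : Fin r → Fin m} (hι : Function.Injective ι)
    (hW : ∀ j k, W k (ι j) = if k = j then 1 else 0) (x : EuclideanSpace ℝ (Fin r)) :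
    ‖toEuclideanLin (tailCoords r U) (toEuclideanLin F x)‖ ≤ 2 * specNorm N * ‖x‖ := by
  -- `R` isometrically selects the pure columns, so `W * R = 1` and `F` is the data minus the noise
  -- on those columns. This costs `ε` twice.
  set R : Matrix (Fin m) (Fin r) ℝ := (1 : Matrix (Fin m) (Fin m) ℝ).submatrix id ι with hR
  have hWR : W * R = 1 := by
    ext k j
    simp [hR, Matrix.mul_apply, one_apply, hW]
  have hRR : Rᵀ * R = 1 := by
    ext k j
    simp [hR, Matrix.mul_apply, one_apply, hι.eq_iff]
  have hn : ‖toEuclideanLin R x‖ = ‖x‖ := norm_toEuclideanLin_of_transpose_mul_self hRR x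
  have hF : toEuclideanLin F x = toEuclideanLin (F * W + N) (toEuclideanLin R x) -
      toEuclideanLin N (toEuclideanLin R x) := by
    rw [map_add, LinearMap.add_apply, add_sub_cancel_right, ← toEuclideanLin_mul_apply,
      Matrix.mul_assoc, hWR, Matrix.mul_one]
  rw [hF, map_sub]
  have h1 := h.norm_tailCoords_le (toEuclideanLin R x)
  have h2 := norm_tailCoords_le_norm (r := r) hrd h.1 (toEuclideanLin N (toEuclideanLin R x))
  have h3 := norm_toEuclideanLin_le_specNorm N (toEuclideanLin R x)
  rw [hn] at h1 h3
  refine (norm_sub_le _ _).trans ?_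
  linarith

lemma isUnit_det_of_norm_le {r : ℕ} {G : Matrix (Fin r) (Fin r) ℝ} {a : ℝ} (ha : 0 < a)
    (hG : ∀ x, a * ‖x‖ ≤ ‖toEuclideanLin G x‖) : IsUnit G.det := by
  rw [isUnit_iff_ne_zero]
  intro h0
  obtain ⟨v, hv, hGv⟩ := Matrix.exists_mulVec_eq_zero_iff.mpr h0
  have h1 := hG (WithLp.toLp 2 v)
  rw [toLpLin_apply, hGv, WithLp.toLp_zero, norm_zero] at h1
  have h2 : ‖(WithLp.toLp 2 v : EuclideanSpace ℝ (Fin r))‖ ≤ 0 := by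
    by_contra! h
    nlinarith
  exact hv (by simpa using h2)

open scoped MatrixOrder in
/-- Robustness of the preconditioned successive projection algorithm, with explicit constants. -/
theorem precondSPAReturns_of_separable {d m r : ℕ} (hr : 1 ≤ r) {A N : Matrix (Fin d) (Fin m) ℝ}
    {F : Matrix (Fin d) (Fin r) ℝ} (hA : SeparableWith A F)
    (hN : specNorm N ≤ 1 / 80000 * (sigmaMin F / (r * √r))) :
    PrecondSPAReturns (A + N) r (fun I =>
      ∃ idx : Fin r → Fin m, Function.Injective idx ∧ Finset.univ.image idx = I ∧
        basisError (A + N) F idx ≤ 4101 * (cond F * specNorm N)) := by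
  have hrd := le_of_rank_eq hA.1
  have hs := sigmaMin_pos hr hA.1
  obtain ⟨W, ι, rfl, hι, hW0, hW1, hWι⟩ := hA.exists_factor
  have hrm : r ≤ m := by simpa using Fintype.card_le_of_injective ι hι
  set ε := specNorm N with hε
  set s := sigmaMin F with hsdef
  have hε0 : 0 ≤ ε := specNorm_nonneg N
  have hr1 : (1 : ℝ) ≤ r := by exact_mod_cast hr
  have hq1 : 1 ≤ √(r : ℝ) := Real.one_le_sqrt.mpr hr1
  have hrr : 1 ≤ r * √(r : ℝ) := one_le_mul_of_one_le_of_one_le hr1 hq1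
  have hεs : ε * (r * √r) ≤ 1 / 80000 * s := by
    rwa [← mul_div_assoc, le_div_iff₀ (by positivity)] at hN
  have hε1 : ε ≤ 1 / 80000 * s := le_trans (le_mul_of_one_le_right hε0 hrr) hεs
  set δ := 2 * ε / s with hδ
  have hδs : s * δ = 2 * ε := by rw [hδ]; field_simp
  have hδ0 : 0 ≤ δ := by positivity
  have hδr : δ * (r * √r) ≤ 1 / 40000 := by
    rw [hδ, div_mul_eq_mul_div, div_le_iff₀ hs]
    linarith
  have hδq : δ * √r ≤ 1 / 40000 := by
    refine le_trans (mul_le_mul_of_nonneg_left ?_ hδ0) hδr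
    exact le_mul_of_one_le_left (by positivity) hr1
  refine ⟨le_min hrd hrm, exists_isSVD _, fun U σ V hSVD => ?_⟩
  set G := (firstCols hrd U)ᵀ * F with hG
  -- The part of `F x` outside the leading subspace is at most `2 * ε * ‖x‖`, far below `s / 2 *
  -- ‖x‖`.
  have hGl : ∀ x, s / 2 * ‖x‖ ≤ ‖toEuclideanLin G x‖ := fun x => by
    have h1 := sigmaMin_le_norm hrd F x
    have h2 := norm_le_firstCols_add_tailCoords hrd hSVD.1 (toEuclideanLin F x)
    have h3 := hSVD.norm_tailCoords_factor_le hrd hι hWι x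
    rw [hG, toEuclideanLin_mul_apply]
    nlinarith [norm_nonneg x]
  have hGu : ∀ x, ‖toEuclideanLin G x‖ ≤ sigmaMax F * ‖x‖ := fun x => by
    rw [hG, toEuclideanLin_mul_apply]
    exact (norm_firstCols_transpose_le hrd hSVD.1 _).trans (norm_toEuclideanLin_le_sigmaMax F x)
  have hGdet : IsUnit G.det := isUnit_det_of_norm_le (by positivity) hGl
  have hGinv : ∀ x, toEuclideanLin G (toEuclideanLin G⁻¹ x) = x := fun x => by
    rw [← toEuclideanLin_mul_apply, Matrix.mul_nonsing_inv _ hGdet]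
    simp
  -- The noise is pulled back through `G` to the weights, where it has size at most `ε / (s / 2) =
  -- δ`.
  set q : Fin m → EuclideanSpace ℝ (Fin r) := fun i =>
    col W i + toEuclideanLin G⁻¹ (col ((firstCols hrd U)ᵀ * N) i) with hq
  have hP : ∀ i, col (reduced (le_min hrd hrm) σ V) i = toEuclideanLin G (q i) := fun i => by
    rw [hSVD.reduced_eq, hq, map_add, hGinv, ← col_mul, hG, Matrix.mul_add, ← Matrix.mul_assoc]
    rfl
  have hqw : ∀ i, ‖q i - col W i‖ ≤ δ := fun i => by
    have h1 : q i - col W i = toEuclideanLin G⁻¹ (col ((firstCols hrd U)ᵀ * N) i) :=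
      add_sub_cancel_left _ _
    have h2 := hGl (q i - col W i)
    rw [h1, hGinv, ← h1] at h2
    have h3 : ‖col ((firstCols hrd U)ᵀ * N) i‖ ≤ ε := by
      rw [col_mul]
      exact (norm_firstCols_transpose_le hrd hSVD.1 _).trans (norm_col_le_specNorm N i)
    rw [hδ, le_div_iff₀ hs]
    linarith
  have hwι : ∀ j, col W (ι j) = EuclideanSpace.single j 1 := fun j => by
    ext k
    simp [col, hWι]
  have hqι : ∀ j, ‖q (ι j) - EuclideanSpace.single j 1‖ ≤ δ := fun j => by
    rw [← hwι]
    exact hqw _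
  have hw1 : ∀ i, ‖col W i‖ ≤ 1 := fun i => by
    rw [EuclideanSpace.norm_eq]
    refine Real.sqrt_le_one.mpr ?_
    calc ∑ k, ‖(col W i) k‖ ^ 2 ≤ (∑ k, ‖(col W i) k‖) ^ 2 :=
          Finset.sum_sq_le_sq_sum_of_nonneg fun _ _ => norm_nonneg _
      _ ≤ 1 := by
          refine pow_le_one₀ (by positivity) ?_
          refine le_trans (le_of_eq (Finset.sum_congr rfl fun k _ => ?_)) (hW1 i)
          exact abs_of_nonneg (hW0 k i)
  have hqn : ∀ i, ‖q i‖ ≤ 1 + δ := fun i => by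
    have h1 := norm_sub_norm_le (q i) (col W i)
    have h2 := hw1 i
    have h3 := hqw i
    linarith
  refine ⟨exists_ellipsoidOptimal hGdet hP ι hδ0 hδr hqι (by linarith) hqn, fun L hL => ?_⟩
  have hLB := transpose_sqrt_mul_sqrt hL.1.1.posSemidef
  set B := CFC.sqrt L
  have hH := bounds_of_ellipsoidOptimal hr hGdet hP ι hδ0 hδr hqι hqn hL hLB
  refine SPALoop.mono ?_ (spaReturns_of_wellConditioned (B * reduced (le_min hrd hrm) σ V)
    (toEuclideanLin (B * G)) (fun x => (hH x).1) (fun x => (hH x).2) (col W) q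
    (fun i j => hW0 j i) hW1 hδ0 hδq hqw (fun j => ⟨ι j, hwι j⟩)
    (fun i => by rw [col_mul, hP, ← toEuclideanLin_mul_apply]))
  rintro I ⟨idx, hinj, himg, hidx⟩
  refine ⟨idx, hinj, himg, ?_⟩
  have : Nonempty (Fin r) := ⟨⟨0, hr⟩⟩
  refine ciSup_le fun j => ?_
  have hκ : 1 ≤ cond F := (one_le_div hs).mpr (sigmaMin_le_sigmaMax F)
  have hM : sigmaMax F = cond F * s := by rw [cond, div_mul_cancel₀ _ hs.ne']
  -- Inside the leading subspace the error is at most `σ_max(F) * 2049 * δ = 4098 * κ * ε`; outside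
  -- it, `ε` from the data column and `2 * ε` from `f_j`. As `κ ≥ 1`, the total is `4101 * κ * ε`.
  have h1 := norm_le_firstCols_add_tailCoords hrd hSVD.1 (col (F * W + N) (idx j) - col F j)
  have h2 : ‖toEuclideanLin (firstCols hrd U)ᵀ (col (F * W + N) (idx j) - col F j)‖
      ≤ 4098 * (cond F * ε) := by
    have h3 : toEuclideanLin (firstCols hrd U)ᵀ (col (F * W + N) (idx j) - col F j)
        = toEuclideanLin G (q (idx j) - EuclideanSpace.single j 1) := by
      rw [map_sub, map_sub, ← hP, hSVD.reduced_eq, col_mul, col_eq_toEuclideanLin F, hG,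
        toEuclideanLin_mul_apply]
    rw [h3]
    refine (hGu _).trans ?_
    rw [hM]
    have h4 : cond F * s * ‖q (idx j) - EuclideanSpace.single j 1‖ ≤ cond F * s * (2049 * δ) :=
      mul_le_mul_of_nonneg_left (hidx j) (by positivity)
    have h5 : cond F * s * (2049 * δ) = 2049 * cond F * (s * δ) := by ring
    rw [h5, hδs] at h4
    linarith
  have h3 : ‖toEuclideanLin (tailCoords r U) (col (F * W + N) (idx j) - col F j)‖ ≤ 3 * ε := by
    rw [map_sub, col_eq_toEuclideanLin, col_eq_toEuclideanLin]
    have h4 := hSVD.norm_tailCoords_le (EuclideanSpace.single (idx j) 1)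
    have h5 := hSVD.norm_tailCoords_factor_le hrd hι hWι (EuclideanSpace.single j 1)
    simp only [PiLp.norm_single, norm_one, mul_one] at h4 h5
    refine (norm_sub_le _ _).trans ?_
    linarith
  have h6 : ε ≤ cond F * ε := le_mul_of_one_le_left hε0 hκ
  linarith

end PrecondSPA

open PrecondSPA in
theorem mainTheorem2 :
    ∃ c : ℝ, 0 < c ∧ ∃ C : ℝ, 0 < C ∧
      ∀ (d m r : ℕ), 1 ≤ r →
      ∀ (A N : Matrix (Fin d) (Fin m) ℝ) (F : Matrix (Fin d) (Fin r) ℝ),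
        SeparableWith A F →
        ∀ ε : ℝ, specNorm N = ε → ε ≤ c * (sigmaMin F / (r * Real.sqrt r)) →
          PrecondSPAReturns (A + N) r (fun I =>
            ∃ idx : Fin r → Fin m, Function.Injective idx ∧ Finset.univ.image idx = I ∧
              basisError (A + N) F idx ≤ C * (cond F * ε)) := by
  refine ⟨1 / 80000, by norm_num, 4101, by norm_num, fun d m r hr A N F hA ε hε hle => ?_⟩
  subst hε
  exact precondSPAReturns_of_separable hr hA hle
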